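/- There are a deterministic algorithm and an absolute constant $C$ such that the following holds. The input consists of a finite simple undirected graph $G$ on $n$ vertices with real edge weights $w(e)\ge 0$, a set $F\subseteq E(G)$ of $f=|F|$ edge faults, a path $\pi$ that is a shortest path in $G\setminus F$ between its endpoints (the weight of a path is the sum of the weights of its edges; paths are simple; a path with a single vertex is allowed), and an integer $k\ge 1$. The algorithm returns - a partition $$\pi=\pi_0\circ e_0\circ\pi_1\circ e_1\circ\dots\circ \pi_{q-1}\circ e_{q-1}\circ\pi_q ,$$ where each $\pi_i$ is a (possibly empty, i.e. single-vertex) subpath of $\pi$, each $e_i$ is a single edge, and $q\le Ck$; and - fault sets $F_0,\dots,F_q\subseteq F$ with $|F_i|\le f/k$ for all $i$, such that each $\pi_i$ is a shortest path in $G\setminus F_i$. The number of steps of the algorithm is bounded by a polynomial in $n$ and $f$. Here steps are counted on a random access machine with unit-cost addition, subtraction and comparison of natural numbers, unit-cost addition, copying and comparison of weights, and unit-cost access to arrays. -/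

import Mathlib

/-! ## Weighted graphs, shortest paths, decompositions -/

namespace Restoration

/-- The weight of a walk: the sum of the weights of its edges. -/
noncomputable def walkWeight {V : Type*} {H : SimpleGraph V} (w : Sym2 V → ℝ) {u v : V}
    (p : H.Walk u v) : ℝ :=
  (p.edges.map w).sum

/-- `p` is a shortest path of the graph `H` with edge weights `w`: it is a (simple) path, and no
path of `H` with the same endpoints has smaller weight. -/
def IsShortestPath {V : Type*} {H : SimpleGraph V} (w : Sym2 V → ℝ) {u v : V}
    (p : H.Walk u v) : Prop :=
  p.IsPath ∧ ∀ p' : H.Walk u v, p'.IsPath → walkWeight w p ≤ walkWeight w p'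

/-- One piece of a decomposition: a set of faults and a walk in `G` minus these faults. -/
structure Piece {V : Type*} (G : SimpleGraph V) where
  faults : Finset (Sym2 V)
  src : V
  tgt : V
  path : (G.deleteEdges (faults : Set (Sym2 V))).Walk src tgt

/-- The walk of a piece, seen as a walk of `G`. -/
def Piece.walk {V : Type*} {G : SimpleGraph V} (P : Piece G) : G.Walk P.src P.tgt :=
  P.path.mapLe (SimpleGraph.deleteEdges_le _)

/-- `IsDecomposition p [P₀, …, P_q]` says that `p = π₀ ∘ e₀ ∘ π₁ ∘ e₁ ∘ ⋯ ∘ e_{q-1} ∘ π_q`, where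
`πᵢ` is the walk of `Pᵢ` (it may consist of a single vertex) and each `eᵢ` is a single edge. -/
inductive IsDecomposition {V : Type*} {G : SimpleGraph V} :
    ∀ {s t : V}, G.Walk s t → List (Piece G) → Prop
  | last (P : Piece G) : IsDecomposition P.walk [P]
  | step (P : Piece G) {x t : V} (e : G.Adj P.tgt x) (r : G.Walk x t) (L : List (Piece G)) :
      IsDecomposition r L → IsDecomposition (P.walk.append (SimpleGraph.Walk.cons e r)) (P :: L)

end Restoration

/-! ## A random access machine with a step count

The memory holds natural numbers and, separately, real weights. The only arithmetic on natural
numbers is addition and truncated subtraction; the only operations on weights are the constant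
zero, addition, copying and comparison. Every operation has unit cost. (There is no multiplication,
so that unit cost is a realistic measure, and no real constant other than zero.) -/

namespace RAM

/-- Memory: scalar variables and one-dimensional arrays, each with a numerical name, for natural
numbers and for weights. -/
structure State where
  nvar : ℕ → ℕ
  narr : ℕ → ℕ → ℕ
  wvar : ℕ → ℝ
  warr : ℕ → ℕ → ℝ

/-- Expressions for natural numbers; `get a i` reads array `a` at index `i`. -/
inductive NExpr
  | lit (c : ℕ)
  | var (x : ℕ)
  | get (a : ℕ) (i : NExpr)
  | add (e₁ e₂ : NExpr)
  | sub (e₁ e₂ : NExpr)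

def NExpr.eval (σ : State) : NExpr → ℕ
  | lit c => c
  | var x => σ.nvar x
  | get a i => σ.narr a (i.eval σ)
  | add e₁ e₂ => e₁.eval σ + e₂.eval σ
  | sub e₁ e₂ => e₁.eval σ - e₂.eval σ

/-- Number of operations in an expression. -/
def NExpr.cost : NExpr → ℕ
  | lit _ => 1
  | var _ => 1
  | get _ i => i.cost + 1
  | add e₁ e₂ => e₁.cost + e₂.cost + 1
  | sub e₁ e₂ => e₁.cost + e₂.cost + 1

/-- Expressions for weights. -/
inductive WExpr
  | zero
  | var (x : ℕ)
  | get (a : ℕ) (i : NExpr)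
  | add (e₁ e₂ : WExpr)

noncomputable def WExpr.eval (σ : State) : WExpr → ℝ
  | zero => 0
  | var x => σ.wvar x
  | get a i => σ.warr a (i.eval σ)
  | add e₁ e₂ => e₁.eval σ + e₂.eval σ

def WExpr.cost : WExpr → ℕ
  | zero => 1
  | var _ => 1
  | get _ i => i.cost + 1
  | add e₁ e₂ => e₁.cost + e₂.cost + 1

/-- Tests: comparisons of natural numbers and of weights, and Boolean combinations. -/
inductive Test
  | nlt (e₁ e₂ : NExpr)
  | wlt (e₁ e₂ : WExpr)
  | not (b : Test)
  | and (b₁ b₂ : Test)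

def Test.Holds (σ : State) : Test → Prop
  | nlt e₁ e₂ => e₁.eval σ < e₂.eval σ
  | wlt e₁ e₂ => e₁.eval σ < e₂.eval σ
  | not b => ¬ b.Holds σ
  | and b₁ b₂ => b₁.Holds σ ∧ b₂.Holds σ

def Test.cost : Test → ℕ
  | nlt e₁ e₂ => e₁.cost + e₂.cost + 1
  | wlt e₁ e₂ => e₁.cost + e₂.cost + 1
  | not b => b.cost + 1
  | and b₁ b₂ => b₁.cost + b₂.cost + 1

/-- Programs. `nset`, `wset` assign a scalar variable, `nput`, `wput` assign an array entry. -/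
inductive Program
  | skip
  | nset (x : ℕ) (e : NExpr)
  | nput (a : ℕ) (i e : NExpr)
  | wset (x : ℕ) (e : WExpr)
  | wput (a : ℕ) (i : NExpr) (e : WExpr)
  | seq (p₁ p₂ : Program)
  | cond (b : Test) (p₁ p₂ : Program)
  | loop (b : Test) (p : Program)

/-- `Exec p σ T σ'`: started in `σ`, the program `p` halts in `σ'` after `T` steps. The body of
`loop b p` is repeated as long as `b` holds. -/
inductive Exec : Program → State → ℕ → State → Prop
  | skip (σ : State) : Exec .skip σ 1 σ
  | nset (σ : State) (x : ℕ) (e : NExpr) :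
      Exec (.nset x e) σ (e.cost + 1)
        { σ with nvar := Function.update σ.nvar x (e.eval σ) }
  | nput (σ : State) (a : ℕ) (i e : NExpr) :
      Exec (.nput a i e) σ (i.cost + e.cost + 1)
        { σ with
          narr := Function.update σ.narr a
            (Function.update (σ.narr a) (i.eval σ) (e.eval σ)) }
  | wset (σ : State) (x : ℕ) (e : WExpr) :
      Exec (.wset x e) σ (e.cost + 1)
        { σ with wvar := Function.update σ.wvar x (e.eval σ) }
  | wput (σ : State) (a : ℕ) (i : NExpr) (e : WExpr) :
      Exec (.wput a i e) σ (i.cost + e.cost + 1)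
        { σ with
          warr := Function.update σ.warr a
            (Function.update (σ.warr a) (i.eval σ) (e.eval σ)) }
  | seq {p₁ p₂ : Program} {σ σ₁ σ₂ : State} {T₁ T₂ : ℕ} :
      Exec p₁ σ T₁ σ₁ → Exec p₂ σ₁ T₂ σ₂ → Exec (.seq p₁ p₂) σ (T₁ + T₂) σ₂
  | cond_true {b : Test} {p₁ p₂ : Program} {σ σ' : State} {T : ℕ} :
      b.Holds σ → Exec p₁ σ T σ' → Exec (.cond b p₁ p₂) σ (b.cost + 1 + T) σ'
  | cond_false {b : Test} {p₁ p₂ : Program} {σ σ' : State} {T : ℕ} :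
      ¬ b.Holds σ → Exec p₂ σ T σ' → Exec (.cond b p₁ p₂) σ (b.cost + 1 + T) σ'
  | loop_true {b : Test} {p : Program} {σ σ₁ σ₂ : State} {T₁ T₂ : ℕ} :
      b.Holds σ → Exec p σ T₁ σ₁ → Exec (.loop b p) σ₁ T₂ σ₂ →
        Exec (.loop b p) σ (b.cost + 1 + T₁ + T₂) σ₂
  | loop_false {b : Test} {p : Program} {σ : State} :
      ¬ b.Holds σ → Exec (.loop b p) σ (b.cost + 1) σ

end RAM

/-! ## Input and output conventions -/

namespace Restoration

/-- The row-major array of an `n × n` matrix: entry `u * n + v` is `M u v`, and all entries from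
`n * n` on are zero. -/
def rowMajor {α : Type*} [Zero α] {n : ℕ} (M : Fin n → Fin n → α) (i : ℕ) : α :=
  if h : i < n * n then M (Fin.divNat ⟨i, h⟩) (Fin.modNat ⟨i, h⟩) else 0

/-- The initial memory on input a graph `G` on `{0, …, n-1}` with edge weights `w`, a list of
faults (each given by its two endpoints), a path (given by its list of vertices), and `k`:
* variables `0, 1, 2, 3` hold `n`, the number of faults, the number of vertices of the path, `k`;
* array `0` is the adjacency matrix, and weight array `0` the matrix of the edge weights (with
  entry zero for pairs that are not edges);
* arrays `1` and `2` list the first and the second endpoints of the faults;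
* array `3` lists the vertices of the path.
Everything else is zero. -/
noncomputable def initState {n : ℕ} (G : SimpleGraph (Fin n)) (w : Sym2 (Fin n) → ℝ)
    (faults : List (Fin n × Fin n)) (path : List (Fin n)) (k : ℕ) : RAM.State :=
  open Classical in
  { nvar := fun x => [n, faults.length, path.length, k].getD x 0
    narr := fun a i =>
      if a = 0 then rowMajor (fun u v : Fin n => if G.Adj u v then 1 else 0) i
      else if a = 1 then (faults.map fun e => (e.1 : ℕ)).getD i 0
      else if a = 2 then (faults.map fun e => (e.2 : ℕ)).getD i 0
      else if a = 3 then (path.map fun v => (v : ℕ)).getD i 0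
      else 0
    wvar := fun _ => 0
    warr := fun a i =>
      if a = 0 then rowMajor (fun u v : Fin n => if G.Adj u v then w s(u, v) else 0) i
      else 0 }

/-- The list lists every element of `F` exactly once, as a pair of endpoints. -/
def Enumerates {V : Type*} (faults : List (V × V)) (F : Finset (Sym2 V)) : Prop :=
  (faults.map fun e => s(e.1, e.2)).Nodup ∧ ∀ e, e ∈ faults.map (fun e => s(e.1, e.2)) ↔ e ∈ F

/-- The memory `σ` holds the pieces `P₀, …, P_q` as output, relative to the input list of `f`
faults: variable `4` holds `q`; arrays `4` and `5` hold the first and the last vertices of the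
pieces; entry `i * f + j` of array `6` is `1` if the `j`-th fault belongs to the fault set of `Pᵢ`
and `0` if not (so each fault set is given by its indicator vector). -/
def HoldsOutput {n : ℕ} {G : SimpleGraph (Fin n)} (σ : RAM.State)
    (faults : List (Fin n × Fin n)) (L : List (Piece G)) : Prop :=
  σ.nvar 4 + 1 = L.length ∧
  ∀ (i : ℕ) (hi : i < L.length),
    σ.narr 4 i = (L[i].src : ℕ) ∧ σ.narr 5 i = (L[i].tgt : ℕ) ∧
    ∀ (j : ℕ) (hj : j < faults.length),
      σ.narr 6 (i * faults.length + j) =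
        if s(faults[j].1, faults[j].2) ∈ L[i].faults then 1 else 0

end Restoration

/-! Fix a potential `φ` of `G` minus `F`: it changes by at most the weight of an edge along every
non-faulty edge. Suppose that it grows along `π` by exactly the weight of `π`. Consider a subpath
from `x` to `y`, and write `a = φ x`, `b = φ y`, so that its weight is `b - a`. Delete only the
faults with an endpoint whose potential lies in the open window `(2a - b, b)`. The subpath is still
shortest: a competing walk from `x` that uses no fault changes `φ` by at most its weight, so it must
pay `b - a` to reach `y`. If it uses a surviving fault, the endpoint at which it enters the fault
has potential at distance at least `b - a` from `a`, so `b - a` has been paid already. Reversing the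
walk and negating `φ` gives the same for the window `(a, 2b - a)`. These are
`sub_le_walkWeight_of_left_window` and `sub_le_walkWeight_of_right_window`.

The division is greedy: a piece grows while one of its two windows contains at most `f / k` faults;
otherwise the edge to the next vertex becomes a separating edge and a new piece starts there. Hence
both windows of each interval between consecutive starts are heavy. Among two adjacent intervals,
the shorter one has a window inside their union. Thus disjoint pairs of intervals give disjoint
windows with more than `f / k` faults each, while a fault, having two endpoints, is counted at most
twice. This bounds the number of separating edges by `4 * k` (`card_intervals_le`).

The machine obtains `φ` by Bellman-Ford from the start of `π`, with the weight `D` of `π` in the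
role of infinity. The result is the distance in `G` minus `F` truncated at `D`, which is still a
potential and equals `D` at the end of `π` (`Estimates.isPotential`, `Estimates.sub_eq`).
`decompose_runs` combines the program with its step bound, and `exists_decomposition` turns the
computed division into pieces. -/

namespace Restoration

/-! ### Weights of walks. -/

open SimpleGraph

variable {V : Type*}

theorem walkWeight_nil {H : SimpleGraph V} (w : Sym2 V → ℝ) (u : V) :
    walkWeight w (Walk.nil : H.Walk u u) = 0 := by simp [walkWeight]

theorem walkWeight_cons {H : SimpleGraph V} (w : Sym2 V → ℝ) {u v x : V} (h : H.Adj u v)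
    (p : H.Walk v x) : walkWeight w (Walk.cons h p) = w s(u, v) + walkWeight w p := by
  simp [walkWeight]

theorem walkWeight_append {H : SimpleGraph V} (w : Sym2 V → ℝ) {u v x : V} (p : H.Walk u v)
    (q : H.Walk v x) : walkWeight w (p.append q) = walkWeight w p + walkWeight w q := by
  simp [walkWeight]

theorem walkWeight_reverse {H : SimpleGraph V} (w : Sym2 V → ℝ) {u v : V} (p : H.Walk u v) :
    walkWeight w p.reverse = walkWeight w p := by
  simp [walkWeight]

theorem walkWeight_mapLe {H H' : SimpleGraph V} (h : H ≤ H') (w : Sym2 V → ℝ) {u v : V}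
    (p : H.Walk u v) : walkWeight w (p.mapLe h) = walkWeight w p := by
  simp [walkWeight]

theorem walkWeight_nonneg {H : SimpleGraph V} {w : Sym2 V → ℝ} (hw : ∀ e ∈ H.edgeSet, 0 ≤ w e)
    {u v : V} (p : H.Walk u v) : 0 ≤ walkWeight w p := by
  apply List.sum_nonneg
  intro a ha
  obtain ⟨e, he, rfl⟩ := List.mem_map.1 ha
  exact hw e (p.edges_subset_edgeSet he)

theorem walkWeight_bypass_le [DecidableEq V] {H : SimpleGraph V} {w : Sym2 V → ℝ}
    (hw : ∀ e ∈ H.edgeSet, 0 ≤ w e) {u v : V} (p : H.Walk u v) :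
    walkWeight w p.bypass ≤ walkWeight w p := by
  apply (p.edges_bypass_sublist_edges.map w).sum_le_sum
  intro a ha
  obtain ⟨e, he, rfl⟩ := List.mem_map.1 ha
  exact hw e (p.edges_subset_edgeSet he)

/-! ### Potentials and windows of faults. -/

/-- `φ` grows by at most the weight of an edge along every edge of `H`. -/
def IsPotential (H : SimpleGraph V) (w : Sym2 V → ℝ) (φ : V → ℝ) : Prop :=
  ∀ x y, H.Adj x y → φ y ≤ φ x + w s(x, y)

theorem IsPotential.sub_le_walkWeight {H : SimpleGraph V} {w : Sym2 V → ℝ} {φ : V → ℝ}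
    (hφ : IsPotential H w φ) {x y : V} (p : H.Walk x y) : φ y - φ x ≤ walkWeight w p := by
  induction p with
  | nil => simp [walkWeight_nil]
  | cons h p ih =>
    rw [walkWeight_cons]
    linarith [hφ _ _ h]

/-- The graph is undirected, so the defining inequality also holds along the reversed edge. This
exchanges left and right windows. -/
theorem IsPotential.neg {H : SimpleGraph V} {w : Sym2 V → ℝ} {φ : V → ℝ}
    (hφ : IsPotential H w φ) : IsPotential H w (fun x => -φ x) := by
  intro x y h
  have := hφ y x h.symm
  rw [Sym2.eq_swap] at this
  linarith

/-- The faults with an endpoint whose potential lies strictly between `lo` and `hi`. -/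
noncomputable def window (φ : V → ℝ) (F : Finset (Sym2 V)) (lo hi : ℝ) : Finset (Sym2 V) :=
  open Classical in F.filter fun e => ∃ x ∈ e, lo < φ x ∧ φ x < hi

theorem mem_window {φ : V → ℝ} {F : Finset (Sym2 V)} {lo hi : ℝ} {e : Sym2 V} :
    e ∈ window φ F lo hi ↔ e ∈ F ∧ ∃ x ∈ e, lo < φ x ∧ φ x < hi := by
  classical simp [window]

theorem window_subset (φ : V → ℝ) (F : Finset (Sym2 V)) (lo hi : ℝ) : window φ F lo hi ⊆ F :=
  fun _ he => (mem_window.1 he).1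

theorem window_mono {φ : V → ℝ} {F : Finset (Sym2 V)} {lo hi lo' hi' : ℝ} (h : lo' ≤ lo)
    (h' : hi ≤ hi') : window φ F lo hi ⊆ window φ F lo' hi' := by
  intro e he
  obtain ⟨h1, x, hx, h2, h3⟩ := mem_window.1 he
  exact mem_window.2 ⟨h1, x, hx, h.trans_lt h2, h3.trans_le h'⟩

/-! ### Subpaths stay shortest when only one window of faults is deleted. -/

section Shortest

variable {G : SimpleGraph V} {w : Sym2 V → ℝ} {F : Finset (Sym2 V)} {φ : V → ℝ}

/-- Form suited to induction along the walk: `a` is the potential at the original start and `c` the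
weight already spent on the way to `u`. -/
theorem sub_le_add_walkWeight_of_left_window (hw : ∀ e ∈ G.edgeSet, 0 ≤ w e)
    (hφ : IsPotential (G.deleteEdges (F : Set (Sym2 V))) w φ) {W : Finset (Sym2 V)} {a : ℝ}
    {u y : V} (p : (G.deleteEdges (W : Set (Sym2 V))).Walk u y)
    (hW : window φ F (2 * a - φ y) (φ y) ⊆ W) (c : ℝ) (hc : |φ u - a| ≤ c) :
    φ y - a ≤ c + walkWeight w p := by
  induction p generalizing c with
  | nil =>
    rw [walkWeight_nil, add_zero]
    exact (le_abs_self _).trans hc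
  | @cons u v y h p ih =>
    have hG : G.Adj u v := (deleteEdges_le _) h
    have hnW : s(u, v) ∉ W := by
      have := (deleteEdges_adj.1 h).2
      simpa using this
    have he : 0 ≤ w s(u, v) := hw _ hG
    have hp : 0 ≤ walkWeight w p :=
      walkWeight_nonneg (fun e he => hw e (edgeSet_mono (deleteEdges_le _) he)) p
    rw [walkWeight_cons]
    by_cases hF : s(u, v) ∈ F
    -- If the bound failed, then `c < φ y - a`, so `u` would lie in the window and the fault `s(u,
    -- v)` would have been deleted.
    · by_contra hlt
      apply hnW
      apply hW
      rw [mem_window]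
      have := abs_le.1 hc
      exact ⟨hF, u, Sym2.mem_mk_left _ _, by linarith, by linarith⟩
    · have hadj : (G.deleteEdges (F : Set (Sym2 V))).Adj u v :=
        deleteEdges_adj.2 ⟨hG, by simpa using hF⟩
      have h1 := hφ _ _ hadj
      have h2 := hφ _ _ hadj.symm
      rw [Sym2.eq_swap] at h2
      have := abs_le.1 hc
      have := ih hW (c + w s(u, v)) (abs_le.2 ⟨by linarith, by linarith⟩)
      linarith

theorem sub_le_walkWeight_of_left_window (hw : ∀ e ∈ G.edgeSet, 0 ≤ w e)
    (hφ : IsPotential (G.deleteEdges (F : Set (Sym2 V))) w φ) {W : Finset (Sym2 V)}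
    {x y : V} (p : (G.deleteEdges (W : Set (Sym2 V))).Walk x y)
    (hW : window φ F (2 * φ x - φ y) (φ y) ⊆ W) : φ y - φ x ≤ walkWeight w p := by
  simpa using sub_le_add_walkWeight_of_left_window hw hφ p hW 0 (by simp)

/-- The right window for `φ` is the left window for `-φ` on the reversed walk. -/
theorem sub_le_walkWeight_of_right_window (hw : ∀ e ∈ G.edgeSet, 0 ≤ w e)
    (hφ : IsPotential (G.deleteEdges (F : Set (Sym2 V))) w φ) {W : Finset (Sym2 V)}
    {x y : V} (p : (G.deleteEdges (W : Set (Sym2 V))).Walk x y)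
    (hW : window φ F (φ x) (2 * φ y - φ x) ⊆ W) : φ y - φ x ≤ walkWeight w p := by
  have := sub_le_walkWeight_of_left_window hw hφ.neg p.reverse (by
    intro e he
    apply hW
    obtain ⟨h1, z, hz, h2, h3⟩ := mem_window.1 he
    exact mem_window.2 ⟨h1, z, hz, by linarith, by linarith⟩)
  rw [walkWeight_reverse] at this
  linarith

theorem exists_append_cons {H : SimpleGraph V} {x t : V} (r : H.Walk x t) (n : ℕ)
    (hn : n < r.length) :
    ∃ (y z : V) (p : H.Walk x y) (e : H.Adj y z) (r' : H.Walk z t),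
      r = p.append (Walk.cons e r') ∧ p.length = n := by
  induction r generalizing n with
  | nil => simp at hn
  | cons h r ih =>
    cases n with
    | zero => exact ⟨_, _, Walk.nil, h, r, rfl, rfl⟩
    | succ n =>
      obtain ⟨y, z, p, e, r', rfl, hp⟩ := ih n (by simpa using hn)
      exact ⟨y, z, Walk.cons h p, e, r', rfl, by simp [hp]⟩

theorem isShortestPath_of_windows (hw : ∀ e ∈ G.edgeSet, 0 ≤ w e)
    (hφ : IsPotential (G.deleteEdges (F : Set (Sym2 V))) w φ) {W : Finset (Sym2 V)} {x y : V}
    (p : (G.deleteEdges (W : Set (Sym2 V))).Walk x y) (hp : p.IsPath)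
    (hpw : walkWeight w p = φ y - φ x)
    (hW : window φ F (2 * φ x - φ y) (φ y) ⊆ W ∨ window φ F (φ x) (2 * φ y - φ x) ⊆ W) :
    IsShortestPath w p := by
  refine ⟨hp, fun p' _ => ?_⟩
  rw [hpw]
  rcases hW with hW | hW
  · exact sub_le_walkWeight_of_left_window hw hφ p' hW
  · exact sub_le_walkWeight_of_right_window hw hφ p' hW

/-- Induction on `q`, splitting off the first piece and the edge after it; the positions of the
remaining pieces are shifted by `en 0 + 1`. The piece and the rest inherit the equality of weight
and potential difference, because each part satisfies the potential inequality and the sum is an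
equality. -/
theorem exists_decomposition (hw : ∀ e ∈ G.edgeSet, 0 ≤ w e)
    (hφ : IsPotential (G.deleteEdges (F : Set (Sym2 V))) w φ) (q : ℕ) {x t : V}
    (r : (G.deleteEdges (F : Set (Sym2 V))).Walk x t) (hr : r.IsPath)
    (hrw : walkWeight w r = φ t - φ x) (st en : ℕ → ℕ) (W : ℕ → Finset (Sym2 V))
    (hst : st 0 = 0) (hle : ∀ j ≤ q, st j ≤ en j) (hlink : ∀ j < q, st (j + 1) = en j + 1)
    (hlast : en q = r.length) (hWF : ∀ j ≤ q, W j ⊆ F)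
    (hW : ∀ j ≤ q,
      window φ F (2 * φ (r.getVert (st j)) - φ (r.getVert (en j))) (φ (r.getVert (en j))) ⊆ W j ∨
      window φ F (φ (r.getVert (st j))) (2 * φ (r.getVert (en j)) - φ (r.getVert (st j))) ⊆ W j) :
    ∃ L : List (Piece G), L.length = q + 1 ∧
      IsDecomposition (r.mapLe (deleteEdges_le _)) L ∧
      ∀ (j : ℕ) (hj : j < L.length), L[j].src = r.getVert (st j) ∧ L[j].tgt = r.getVert (en j) ∧
        L[j].faults = W j ∧ IsShortestPath w L[j].path := by
  induction q generalizing x st en W with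
  | zero =>
    have hle' : G.deleteEdges (F : Set (Sym2 V)) ≤ G.deleteEdges (W 0 : Set (Sym2 V)) :=
      deleteEdges_anti (by exact_mod_cast hWF 0 le_rfl)
    let P : Piece G := ⟨W 0, x, t, r.mapLe hle'⟩
    have hP : P.walk = r.mapLe (deleteEdges_le _) := by
      simp only [Piece.walk, P, Walk.mapLe]
      rw [Walk.map_map]
      rfl
    refine ⟨[P], rfl, hP ▸ IsDecomposition.last P, ?_⟩
    intro j hj
    obtain rfl : j = 0 := by simpa using hj
    have h0 := hW 0 le_rfl
    simp only [hst, hlast, Walk.getVert_zero, Walk.getVert_length] at h0 ⊢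
    exact ⟨rfl, rfl, rfl, isShortestPath_of_windows hw hφ _ (hr.mapLe _)
      ((walkWeight_mapLe hle' w r).trans hrw) h0⟩
  | succ q ih =>
    -- Each later piece ends at least one position further on. Hence the first piece is followed by
    -- an edge, and the truncated subtractions in the shifted positions are exact.
    have hmono : ∀ j ≤ q + 1, en 0 + j ≤ en j := by
      intro j
      induction j with
      | zero => simp
      | succ j ihj =>
        intro hj
        have h1 := ihj (by omega)
        have h2 := hlink j (by omega)
        have h3 := hle (j + 1) hj
        omega
    have hlen : en 0 < r.length := by
      have := hmono (q + 1) le_rfl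
      omega
    obtain ⟨y, z, p, e, r', rfl, hp⟩ := exists_append_cons r (en 0) hlen
    have hle' : G.deleteEdges (F : Set (Sym2 V)) ≤ G.deleteEdges (W 0 : Set (Sym2 V)) :=
      deleteEdges_anti (by exact_mod_cast hWF 0 (Nat.zero_le _))
    have hr1 : p.IsPath := hr.of_append_left
    have hr2 : r'.IsPath := hr.of_append_right.of_cons
    rw [walkWeight_append, walkWeight_cons] at hrw
    have hpw := hφ.sub_le_walkWeight p
    have hew := hφ _ _ e
    have hrw' := hφ.sub_le_walkWeight r'
    have hpw' : walkWeight w p = φ y - φ x := by linarith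
    have hvert : ∀ i, en 0 + 1 ≤ i →
        (p.append (Walk.cons e r')).getVert i = r'.getVert (i - (en 0 + 1)) := by
      intro i hi
      rw [Walk.getVert_append, if_neg (by omega), hp,
        show i - en 0 = (i - (en 0 + 1)) + 1 by omega, Walk.getVert_cons_succ]
    have hst' : ∀ j ≤ q, en 0 + 1 ≤ st (j + 1) := by
      intro j hj
      have h1 := hlink j (by omega)
      have h2 := hmono j (by omega)
      omega
    have hen' : ∀ j ≤ q, en 0 + 1 ≤ en (j + 1) := by
      intro j hj
      have := hmono (j + 1) (by omega)
      omega
    obtain ⟨L, hL, hdec, hprop⟩ := ih r' hr2 (by linarith) (fun j => st (j + 1) - (en 0 + 1))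
      (fun j => en (j + 1) - (en 0 + 1)) (fun j => W (j + 1))
      (by simp [hlink 0]) (fun j hj => Nat.sub_le_sub_right (hle (j + 1) (by omega)) _)
      (fun j hj => by
        have h1 := hlink (j + 1) (by omega)
        have h2 := hen' j (by omega)
        omega)
      (by
        simp only [hlast, Walk.length_append, Walk.length_cons, hp]
        omega)
      (fun j hj => hWF (j + 1) (by omega))
      (fun j hj => by
        have := hW (j + 1) (by omega)
        rwa [hvert _ (hst' j hj), hvert _ (hen' j hj)] at this)
    let P : Piece G := ⟨W 0, x, y, p.mapLe hle'⟩
    have hP : P.walk = p.mapLe (deleteEdges_le _) := by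
      simp only [Piece.walk, P, Walk.mapLe]
      rw [Walk.map_map]
      rfl
    have e' : G.Adj y z := deleteEdges_le _ e
    refine ⟨P :: L, by simp [hL], ?_, ?_⟩
    · have := IsDecomposition.step P (show G.Adj P.tgt z from e') _ L hdec
      rw [hP] at this
      rw [Walk.mapLe_append]
      exact this
    · have hx : (p.append (Walk.cons e r')).getVert (st 0) = x := by rw [hst, Walk.getVert_zero]
      have hy : (p.append (Walk.cons e r')).getVert (en 0) = y := by
        rw [Walk.getVert_append, hp, if_neg (lt_irrefl _), Nat.sub_self, Walk.getVert_zero]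
      intro j hj
      cases j with
      | zero =>
        have h0 := hW 0 (Nat.zero_le _)
        rw [hx, hy] at h0 ⊢
        exact ⟨rfl, rfl, rfl, isShortestPath_of_windows hw hφ _ (hr1.mapLe _)
          ((walkWeight_mapLe hle' w p).trans hpw') h0⟩
      | succ j =>
        have hj' : j < L.length := by simpa using hj
        have := hprop j hj'
        rw [hvert _ (hst' j (by omega)), hvert _ (hen' j (by omega))]
        exact this

end Shortest

/-! ### Counting the intervals of a greedy division. -/

/-- Disjoint windows contain every fault at most twice. -/
theorem sum_card_window_le (φ : V → ℝ) (F : Finset (Sym2 V)) (m : ℕ) (p : ℕ → ℝ)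
    (hp : ∀ i < m, p i ≤ p (i + 1)) :
    ∑ i ∈ Finset.range m, (window φ F (p i) (p (i + 1))).card ≤ 2 * F.card := by
  classical
  have hmono : ∀ i j, i ≤ j → j ≤ m → p i ≤ p j := by
    intro i j hij
    induction j, hij using Nat.le_induction with
    | base => simp
    | succ j _ ih => exact fun h => (ih (by omega)).trans (hp j (by omega))
  have huniq : ∀ x : V,
      ((Finset.range m).filter fun i => p i < φ x ∧ φ x < p (i + 1)).card ≤ 1 := by
    intro x
    rw [Finset.card_le_one]
    have key : ∀ i j, i < j → j < m → p j < φ x → φ x < p (i + 1) → False := by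
      intro i j hij hj h1 h2
      linarith [hmono (i + 1) j hij hj.le]
    intro i hi j hj
    simp only [Finset.mem_filter, Finset.mem_range] at hi hj
    rcases lt_trichotomy i j with h | h | h
    · exact (key i j h hj.1 hj.2.1 hi.2.2).elim
    · exact h
    · exact (key j i h hi.1 hi.2.1 hj.2.2).elim
  have hswap : ∑ i ∈ Finset.range m, (window φ F (p i) (p (i + 1))).card =
      ∑ e ∈ F, ((Finset.range m).filter fun i => ∃ x ∈ e, p i < φ x ∧ φ x < p (i + 1)).card := by
    simp only [window]
    exact Finset.sum_card_bipartiteAbove_eq_sum_card_bipartiteBelow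
      (fun i e => ∃ x ∈ e, p i < φ x ∧ φ x < p (i + 1))
  rw [hswap]
  calc _ ≤ ∑ _e ∈ F, 2 := by
        apply Finset.sum_le_sum
        intro e _
        induction e using Sym2.inductionOn with
        | hf x y =>
          have : ((Finset.range m).filter fun i => ∃ z ∈ s(x, y), p i < φ z ∧ φ z < p (i + 1)) ⊆
              ((Finset.range m).filter fun i => p i < φ x ∧ φ x < p (i + 1)) ∪
              ((Finset.range m).filter fun i => p i < φ y ∧ φ y < p (i + 1)) := by
            intro i
            simp only [Finset.mem_filter, Finset.mem_union, Sym2.mem_iff]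
            rintro ⟨h1, z, rfl | rfl, h2⟩
            · exact Or.inl ⟨h1, h2⟩
            · exact Or.inr ⟨h1, h2⟩
          exact (Finset.card_le_card this).trans ((Finset.card_union_le _ _).trans
            (Nat.add_le_add (huniq x) (huniq y)))
    _ = _ := by simp [mul_comm]

/-- If both windows of every interval of a subdivision have more than `|F| / k` faults, then the
subdivision has fewer than `4 * k` intervals. -/
theorem card_intervals_le (φ : V → ℝ) (F : Finset (Sym2 V)) (k q : ℕ) (hk : 1 ≤ k) (p : ℕ → ℝ)
    (hp : ∀ i < q, p i ≤ p (i + 1))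
    (hbad : ∀ i < q, F.card < k * (window φ F (2 * p i - p (i + 1)) (p (i + 1))).card ∧
      F.card < k * (window φ F (p i) (2 * p (i + 1) - p i)).card) :
    q ≤ 4 * k := by
  have hpair : ∀ i < q / 2, F.card + 1 ≤ k * (window φ F (p (2 * i)) (p (2 * (i + 1)))).card := by
    intro i hi
    have h1 := hbad (2 * i) (by omega)
    have h2 := hbad (2 * i + 1) (by omega)
    rw [show 2 * (i + 1) = 2 * i + 1 + 1 by ring]
    have h3 := hp (2 * i) (by omega)
    have h4 := hp (2 * i + 1) (by omega)
    -- If the first interval is the shorter one, its right window stays within the pair; otherwise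
    -- the left window of the second does.
    rcases le_total (p (2 * i + 1) - p (2 * i)) (p (2 * i + 1 + 1) - p (2 * i + 1)) with h | h
    · refine h1.2.trans_le (Nat.mul_le_mul_left _ (Finset.card_le_card (window_mono le_rfl ?_)))
      linarith
    · refine h2.1.trans_le (Nat.mul_le_mul_left _ (Finset.card_le_card (window_mono ?_ le_rfl)))
      linarith
  have hsum := sum_card_window_le φ F (q / 2) (fun i => p (2 * i)) (fun i hi =>
    (hp (2 * i) (by omega)).trans (hp (2 * i + 1) (by omega)))
  have h : (q / 2) * (F.card + 1) ≤ k * (2 * F.card) := by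
    calc (q / 2) * (F.card + 1) = ∑ _i ∈ Finset.range (q / 2), (F.card + 1) := by simp
      _ ≤ ∑ i ∈ Finset.range (q / 2), k * (window φ F (p (2 * i)) (p (2 * (i + 1)))).card :=
          Finset.sum_le_sum fun i hi => hpair i (Finset.mem_range.1 hi)
      _ = k * ∑ i ∈ Finset.range (q / 2), (window φ F (p (2 * i)) (p (2 * (i + 1)))).card := by
          rw [Finset.mul_sum]
      _ ≤ _ := Nat.mul_le_mul_left _ hsum
  -- Otherwise `2 * k * (|F| + 1) ≤ 2 * k * |F|`, which is impossible as `k ≥ 1`.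
  have : q / 2 < 2 * k := by
    by_contra hlt
    have := Nat.mul_le_mul_right (F.card + 1) (not_lt.1 hlt)
    nlinarith
  omega

end Restoration

/-! ### Total correctness with step bounds for machine programs. -/

namespace RAM

/-- From `σ`, the program `p` halts within `B` steps in a state satisfying `Q`. -/
def Runs (p : Program) (σ : State) (B : ℕ) (Q : State → Prop) : Prop :=
  ∃ T σ', Exec p σ T σ' ∧ T ≤ B ∧ Q σ'

theorem Runs.mono {p : Program} {σ : State} {B B' : ℕ} {Q Q' : State → Prop}
    (h : Runs p σ B Q) (hB : B ≤ B') (hQ : ∀ σ, Q σ → Q' σ) : Runs p σ B' Q' := by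
  obtain ⟨T, σ', h1, h2, h3⟩ := h
  exact ⟨T, σ', h1, h2.trans hB, hQ _ h3⟩

theorem Runs.seq {p₁ p₂ : Program} {σ : State} {B₁ B₂ : ℕ} {R Q : State → Prop}
    (h₁ : Runs p₁ σ B₁ R) (h₂ : ∀ σ', R σ' → Runs p₂ σ' B₂ Q) :
    Runs (.seq p₁ p₂) σ (B₁ + B₂) Q := by
  obtain ⟨T, σ', h1, h2, h3⟩ := h₁
  obtain ⟨T', σ'', h1', h2', h3'⟩ := h₂ σ' h3
  exact ⟨_, _, .seq h1 h1', Nat.add_le_add h2 h2', h3'⟩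

theorem Runs.cond {b : Test} {p₁ p₂ : Program} {σ : State} {B : ℕ} {Q : State → Prop}
    (h₁ : b.Holds σ → Runs p₁ σ B Q) (h₂ : ¬ b.Holds σ → Runs p₂ σ B Q) :
    Runs (.cond b p₁ p₂) σ (b.cost + 1 + B) Q := by
  by_cases h : b.Holds σ
  · obtain ⟨T, σ', h1, h2, h3⟩ := h₁ h
    exact ⟨_, _, .cond_true h h1, Nat.add_le_add_left h2 _, h3⟩
  · obtain ⟨T, σ', h1, h2, h3⟩ := h₂ h
    exact ⟨_, _, .cond_false h h1, Nat.add_le_add_left h2 _, h3⟩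

/-- The counter lives in the invariant only; `htest` makes the test fail exactly at `N`, which
yields termination. -/
theorem Runs.loop {b : Test} {p : Program} {B : ℕ} (I : ℕ → State → Prop) (i N : ℕ) {σ : State}
    (hi : i ≤ N) (h0 : I i σ) (htest : ∀ j σ, I j σ → (b.Holds σ ↔ j < N))
    (hstep : ∀ j < N, i ≤ j → ∀ σ, I j σ → Runs p σ B (I (j + 1))) :
    Runs (.loop b p) σ ((N - i) * (b.cost + 1 + B) + (b.cost + 1)) (I N) := by
  obtain ⟨d, rfl⟩ := Nat.exists_eq_add_of_le hi
  induction d generalizing i σ with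
  | zero =>
    exact ⟨_, _, .loop_false (by rw [htest _ _ h0]; simp), by simp, h0⟩
  | succ d ih =>
    obtain ⟨T, σ', h1, h2, h3⟩ := hstep i (by omega) le_rfl σ h0
    obtain ⟨T', σ'', h1', h2', h3'⟩ := ih (i + 1) h3 (by omega)
      (fun j σ hj => by rw [htest j σ hj, show i + (d + 1) = i + 1 + d by ring])
      (fun j hj hij σ hI => hstep j (by omega) (by omega) σ hI)
    refine ⟨_, _, .loop_true ((htest _ _ h0).2 (by omega)) h1 h1', ?_, ?_⟩
    · rw [show i + (d + 1) - i = d + 1 by omega]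
      rw [show i + 1 + d - (i + 1) = d by omega] at h2'
      rw [Nat.succ_mul]
      omega
    · rwa [show i + (d + 1) = i + 1 + d by ring]

/-- The step bound uses an upper bound `X` of the number of rounds, so that nested loops are all
measured by one parameter. -/
theorem Runs.for {b : Test} {p : Program} {B : ℕ} (I : ℕ → State → Prop) (N X : ℕ) {σ : State}
    (hX : N ≤ X) (h0 : I 0 σ) (htest : ∀ j σ, I j σ → (b.Holds σ ↔ j < N))
    (hstep : ∀ j < N, ∀ σ, I j σ → Runs p σ B (I (j + 1))) :
    Runs (.loop b p) σ (X * (b.cost + 1 + B) + (b.cost + 1)) (I N) :=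
  (Runs.loop I 0 N (Nat.zero_le _) h0 htest fun j hj _ => hstep j hj).mono
    (Nat.add_le_add_right (Nat.mul_le_mul_right _ (by simpa using hX)) _) fun _ h => h

/-- Programs without loops. -/
def Program.LoopFree : Program → Prop
  | .seq p₁ p₂ => p₁.LoopFree ∧ p₂.LoopFree
  | .cond _ p₁ p₂ => p₁.LoopFree ∧ p₂.LoopFree
  | .loop _ _ => False
  | _ => True

/-- The effect of a program without loops. -/
noncomputable def Program.run : Program → State → State
  | .skip, σ => σ
  | .nset x e, σ => { σ with nvar := Function.update σ.nvar x (e.eval σ) }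
  | .nput a i e, σ =>
      { σ with
        narr := Function.update σ.narr a (Function.update (σ.narr a) (i.eval σ) (e.eval σ)) }
  | .wset x e, σ => { σ with wvar := Function.update σ.wvar x (e.eval σ) }
  | .wput a i e, σ =>
      { σ with
        warr := Function.update σ.warr a (Function.update (σ.warr a) (i.eval σ) (e.eval σ)) }
  | .seq p₁ p₂, σ => p₂.run (p₁.run σ)
  | .cond b p₁ p₂, σ => open Classical in if b.Holds σ then p₁.run σ else p₂.run σ
  | .loop _ _, σ => σ

/-- A bound on the number of steps of a program without loops. -/
def Program.bound : Program → ℕ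
  | .skip => 1
  | .nset _ e => e.cost + 1
  | .nput _ i e => i.cost + e.cost + 1
  | .wset _ e => e.cost + 1
  | .wput _ i e => i.cost + e.cost + 1
  | .seq p₁ p₂ => p₁.bound + p₂.bound
  | .cond b p₁ p₂ => b.cost + 1 + (p₁.bound + p₂.bound)
  | .loop _ _ => 0

theorem Program.LoopFree.exec {p : Program} (hp : p.LoopFree) (σ : State) :
    ∃ T ≤ p.bound, Exec p σ T (p.run σ) := by
  induction p generalizing σ with
  | skip => exact ⟨_, le_rfl, .skip σ⟩
  | nset x e => exact ⟨_, le_rfl, .nset σ x e⟩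
  | nput a i e => exact ⟨_, le_rfl, .nput σ a i e⟩
  | wset x e => exact ⟨_, le_rfl, .wset σ x e⟩
  | wput a i e => exact ⟨_, le_rfl, .wput σ a i e⟩
  | seq p₁ p₂ ih₁ ih₂ =>
    obtain ⟨T₁, h₁, e₁⟩ := ih₁ hp.1 σ
    obtain ⟨T₂, h₂, e₂⟩ := ih₂ hp.2 (p₁.run σ)
    exact ⟨_, Nat.add_le_add h₁ h₂, .seq e₁ e₂⟩
  | cond b p₁ p₂ ih₁ ih₂ =>
    by_cases hb : b.Holds σ
    · obtain ⟨T, h, e⟩ := ih₁ hp.1 σ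
      refine ⟨_, ?_, by simpa [run, hb] using Exec.cond_true hb e⟩
      simp only [bound]
      omega
    · obtain ⟨T, h, e⟩ := ih₂ hp.2 σ
      refine ⟨_, ?_, by simpa [run, hb] using Exec.cond_false hb e⟩
      simp only [bound]
      omega
  | loop b p => exact hp.elim

theorem Program.LoopFree.runs {p : Program} (hp : p.LoopFree) {σ : State} {Q : State → Prop}
    (h : Q (p.run σ)) : Runs p σ p.bound Q := by
  obtain ⟨T, h1, h2⟩ := hp.exec σ
  exact ⟨T, _, h2, h1, h⟩

end RAM

/-! ### Untouched memory and counting loops. -/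

namespace RAM

/-- `σ'` differs from `σ` at most in the scalar variables `xs`, `ys` and the arrays `as`, `bs`. -/
structure Frame (xs as ys bs : List ℕ) (σ σ' : State) : Prop where
  nvar : ∀ x ∉ xs, σ'.nvar x = σ.nvar x
  narr : ∀ a ∉ as, σ'.narr a = σ.narr a
  wvar : ∀ x ∉ ys, σ'.wvar x = σ.wvar x
  warr : ∀ a ∉ bs, σ'.warr a = σ.warr a

theorem Frame.refl (xs as ys bs : List ℕ) (σ : State) : Frame xs as ys bs σ σ :=
  ⟨fun _ _ => rfl, fun _ _ => rfl, fun _ _ => rfl, fun _ _ => rfl⟩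

theorem Frame.trans {xs as ys bs : List ℕ} {σ₁ σ₂ σ₃ : State} (h : Frame xs as ys bs σ₁ σ₂)
    (h' : Frame xs as ys bs σ₂ σ₃) : Frame xs as ys bs σ₁ σ₃ :=
  ⟨fun x hx => (h'.nvar x hx).trans (h.nvar x hx), fun a ha => (h'.narr a ha).trans (h.narr a ha),
    fun x hx => (h'.wvar x hx).trans (h.wvar x hx), fun a ha => (h'.warr a ha).trans (h.warr a ha)⟩

theorem Frame.mono {xs as ys bs xs' as' ys' bs' : List ℕ} {σ σ' : State}
    (h : Frame xs as ys bs σ σ') (h1 : xs ⊆ xs') (h2 : as ⊆ as') (h3 : ys ⊆ ys') (h4 : bs ⊆ bs') :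
    Frame xs' as' ys' bs' σ σ' :=
  ⟨fun x hx => h.nvar x fun hx' => hx (h1 hx'), fun x hx => h.narr x fun hx' => hx (h2 hx'),
    fun x hx => h.wvar x fun hx' => hx (h3 hx'), fun x hx => h.warr x fun hx' => hx (h4 hx')⟩

/-- All assignments of a program are to the scalar variables `xs`, `ys` and the arrays `as`, `bs`. -/
def Program.Within (xs as ys bs : List ℕ) : Program → Prop
  | .skip => True
  | .nset x _ => x ∈ xs
  | .nput a _ _ => a ∈ as
  | .wset x _ => x ∈ ys
  | .wput a _ _ => a ∈ bs
  | .seq p₁ p₂ => p₁.Within xs as ys bs ∧ p₂.Within xs as ys bs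
  | .cond _ p₁ p₂ => p₁.Within xs as ys bs ∧ p₂.Within xs as ys bs
  | .loop _ p => p.Within xs as ys bs

theorem Exec.frame {xs as ys bs : List ℕ} {p : Program} {σ σ' : State} {T : ℕ}
    (h : Exec p σ T σ') (hp : p.Within xs as ys bs) : Frame xs as ys bs σ σ' := by
  induction h with
  | skip σ => exact .refl _ _ _ _ _
  | nset σ x e =>
    refine ⟨fun y hy => Function.update_of_ne ?_ _ _, fun _ _ => rfl, fun _ _ => rfl, fun _ _ => rfl⟩
    rintro rfl
    exact hy hp
  | nput σ a i e =>
    refine ⟨fun _ _ => rfl, fun y hy => Function.update_of_ne ?_ _ _, fun _ _ => rfl, fun _ _ => rfl⟩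
    rintro rfl
    exact hy hp
  | wset σ x e =>
    refine ⟨fun _ _ => rfl, fun _ _ => rfl, fun y hy => Function.update_of_ne ?_ _ _, fun _ _ => rfl⟩
    rintro rfl
    exact hy hp
  | wput σ a i e =>
    refine ⟨fun _ _ => rfl, fun _ _ => rfl, fun _ _ => rfl, fun y hy => Function.update_of_ne ?_ _ _⟩
    rintro rfl
    exact hy hp
  | seq _ _ ih₁ ih₂ => exact (ih₁ hp.1).trans (ih₂ hp.2)
  | cond_true _ _ ih => exact ih hp.1
  | cond_false _ _ ih => exact ih hp.2
  | loop_true _ _ _ ih₁ ih₂ => exact (ih₁ hp).trans (ih₂ hp)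
  | loop_false _ => exact .refl _ _ _ _ _

theorem Runs.frame {p : Program} {σ : State} {B : ℕ} {Q : State → Prop} (h : Runs p σ B Q)
    {xs as ys bs : List ℕ} (hp : p.Within xs as ys bs) :
    Runs p σ B fun σ' => Frame xs as ys bs σ σ' ∧ Q σ' := by
  obtain ⟨T, σ', h1, h2, h3⟩ := h
  exact ⟨T, σ', h1, h2, h1.frame hp, h3⟩

/-- A counting loop with invariant `I`, preceded by initializations. -/
theorem Runs.initFor {p₀ p : Program} {b : Test} {xs as ys bs : List ℕ} {B B' : ℕ}
    (I : ℕ → State → Prop) (N X : ℕ) {σ : State} (hX : N ≤ X) (hp₀ : p₀.LoopFree)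
    (hw : (Program.seq p₀ (.loop b p)).Within xs as ys bs) (h0 : I 0 (p₀.run σ))
    (htest : ∀ j σ', Frame xs as ys bs σ σ' → I j σ' → (b.Holds σ' ↔ j < N))
    (hstep : ∀ j < N, ∀ σ', Frame xs as ys bs σ σ' → I j σ' → Runs p σ' B (I (j + 1)))
    (hB : p₀.bound + (X * (b.cost + 1 + B) + (b.cost + 1)) ≤ B') :
    Runs (.seq p₀ (.loop b p)) σ B' fun σ' => Frame xs as ys bs σ σ' ∧ I N σ' := by
  refine Runs.mono (Runs.seq (R := fun σ' => Frame xs as ys bs σ σ' ∧ I 0 σ')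
    ((hp₀.runs h0).frame hw.1) fun σ₁ h => Runs.for
      (fun j σ' => Frame xs as ys bs σ σ' ∧ I j σ') N X hX h ?_ ?_) hB fun _ h => h
  · exact fun j σ' h => htest j σ' h.1 h.2
  · intro j hj σ' h
    exact ((hstep j hj σ' h.1 h.2).frame hw.2).mono le_rfl fun _ h' => ⟨h.1.trans h'.1, h'.2⟩

theorem Program.LoopFree.runs_le {p : Program} (hp : p.LoopFree) {σ : State} {Q : State → Prop}
    {B : ℕ} (h : Q (p.run σ)) (hB : p.bound ≤ B) : Runs p σ B Q :=
  (hp.runs h).mono hB fun _ h => h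

/-! ### Programs for the preprocessing and for Bellman-Ford. -/

open NExpr in
/-- Array `7` receives the offsets of the rows of an `n × n` matrix. -/
def rowOffsets : Program :=
  .seq (.seq (.nset 5 (lit 0)) (.nset 11 (lit 0)))
    (.loop (.nlt (var 5) (var 0))
      (.seq (.nput 7 (var 5) (var 11))
        (.seq (.nset 11 (add (var 11) (var 0))) (.nset 5 (add (var 5) (lit 1))))))

theorem rowOffsets_runs (σ : State) (X : ℕ) (hX : σ.nvar 0 ≤ X) :
    Runs rowOffsets σ (100 * X + 100) fun σ' =>
      Frame [5, 11] [7] [] [] σ σ' ∧ ∀ i < σ.nvar 0, σ'.narr 7 i = i * σ.nvar 0 := by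
  refine (Runs.initFor (B := 20) (fun i σ' => σ'.nvar 5 = i ∧ σ'.nvar 11 = i * σ.nvar 0 ∧
      ∀ i' < i, σ'.narr 7 i' = i' * σ.nvar 0) (σ.nvar 0) X hX (by simp [Program.LoopFree])
    (by simp [Program.Within]) (by simp [Program.run, NExpr.eval]) ?_ ?_ ?_).mono le_rfl
      fun σ' h => ⟨h.1, h.2.2.2⟩
  · rintro j σ' hF ⟨h5, -⟩
    simp [Test.Holds, NExpr.eval, hF.nvar, h5]
  · rintro j hj σ' hF ⟨h5, h11, h7⟩
    refine Program.LoopFree.runs_le (by simp [Program.LoopFree]) ?_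
      (by simp [Program.bound, NExpr.cost])
    simp only [Program.run, NExpr.eval]
    refine ⟨by simp [h5], by simp [h11, hF.nvar, Nat.succ_mul], ?_⟩
    intro i' hi'
    rcases Nat.lt_succ_iff_lt_or_eq.1 hi' with h | rfl
    · simp [h5, Function.update_of_ne h.ne, h7 i' h]
    · simp [h5, h11]
  · simp [Program.bound, NExpr.cost, Test.cost]
    omega

open NExpr in
/-- Delete the faults from the adjacency matrix. -/
def deleteFaults : Program :=
  .seq (.nset 5 (lit 0))
    (.loop (.nlt (var 5) (var 1))
      -- Without multiplication, the matrix index `u * n + v` is formed from the table of row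
      -- offsets in array `7`. Both orientations of the fault are cleared.
      (.seq (.nput 0 (add (get 7 (get 1 (var 5))) (get 2 (var 5))) (lit 0))
        (.seq (.nput 0 (add (get 7 (get 2 (var 5))) (get 1 (var 5))) (lit 0))
          (.nset 5 (add (var 5) (lit 1))))))

theorem deleteFaults_runs (σ : State) (X : ℕ) (hX : σ.nvar 1 ≤ X)
    (h7 : ∀ i < σ.nvar 0, σ.narr 7 i = i * σ.nvar 0)
    (h1 : ∀ j < σ.nvar 1, σ.narr 1 j < σ.nvar 0) (h2 : ∀ j < σ.nvar 1, σ.narr 2 j < σ.nvar 0) :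
    Runs deleteFaults σ (100 * X + 100) fun σ' =>
      Frame [5] [0] [] [] σ σ' ∧ ∀ x, 0 < σ'.narr 0 x ↔ 0 < σ.narr 0 x ∧ ∀ j < σ.nvar 1,
        x ≠ σ.narr 1 j * σ.nvar 0 + σ.narr 2 j ∧ x ≠ σ.narr 2 j * σ.nvar 0 + σ.narr 1 j := by
  refine (Runs.initFor (B := 40) (fun i σ' => σ'.nvar 5 = i ∧
      ∀ x, 0 < σ'.narr 0 x ↔ 0 < σ.narr 0 x ∧ ∀ j < i,
        x ≠ σ.narr 1 j * σ.nvar 0 + σ.narr 2 j ∧ x ≠ σ.narr 2 j * σ.nvar 0 + σ.narr 1 j)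
    (σ.nvar 1) X hX (by simp [Program.LoopFree])
    (by simp [Program.Within]) (by simp [Program.run, NExpr.eval]) ?_ ?_ ?_).mono le_rfl
      fun σ' h => ⟨h.1, h.2.2⟩
  · rintro j σ' hF ⟨h5, -⟩
    simp [Test.Holds, NExpr.eval, hF.nvar, h5]
  · rintro j hj σ' hF ⟨h5, h0⟩
    refine Program.LoopFree.runs_le (by simp [Program.LoopFree]) ?_
      (by simp [Program.bound, NExpr.cost])
    simp only [Program.run, NExpr.eval]
    refine ⟨by simp [h5], ?_⟩
    intro x
    have e1 := h7 _ (h1 j hj)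
    have e2 := h7 _ (h2 j hj)
    simp only [h5, Function.update_self, hF.narr 1 (by decide), hF.narr 2 (by decide),
      hF.narr 7 (by decide), e1, e2, Function.update_of_ne (show (7 : ℕ) ≠ 0 by decide),
      Function.update_of_ne (show (1 : ℕ) ≠ 0 by decide),
      Function.update_of_ne (show (2 : ℕ) ≠ 0 by decide), Nat.forall_lt_succ_right]
    simp only [Function.update_apply]
    split_ifs with c1 c2
    · simp [c1]
    · simp [c2]
    · rw [h0]
      tauto
  · simp [Program.bound, NExpr.cost, Test.cost]
    omega

open NExpr in
/-- The scalar weight `0` receives the weight of the path. -/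
def pathWeight : Program :=
  .seq (.seq (.nset 5 (lit 0)) (.wset 0 .zero))
    (.loop (.nlt (add (var 5) (lit 1)) (var 2))
      (.seq (.wset 0 (.add (.var 0)
          (.get 0 (add (get 7 (get 3 (var 5))) (get 3 (add (var 5) (lit 1)))))))
        (.nset 5 (add (var 5) (lit 1)))))

theorem pathWeight_runs (σ : State) (X : ℕ) (hX : σ.nvar 2 ≤ X)
    (h7 : ∀ i < σ.nvar 0, σ.narr 7 i = i * σ.nvar 0)
    (h3 : ∀ j < σ.nvar 2, σ.narr 3 j < σ.nvar 0) :
    Runs pathWeight σ (100 * X + 100) fun σ' =>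
      Frame [5] [] [0] [] σ σ' ∧ σ'.wvar 0 = ∑ i ∈ Finset.range (σ.nvar 2 - 1),
        σ.warr 0 (σ.narr 3 i * σ.nvar 0 + σ.narr 3 (i + 1)) := by
  refine (Runs.initFor (B := 40) (fun i σ' => σ'.nvar 5 = i ∧
      σ'.wvar 0 = ∑ i ∈ Finset.range i, σ.warr 0 (σ.narr 3 i * σ.nvar 0 + σ.narr 3 (i + 1)))
    (σ.nvar 2 - 1) X (by omega) (by simp [Program.LoopFree])
    (by simp [Program.Within]) (by simp [Program.run, NExpr.eval, WExpr.eval]) ?_ ?_ ?_).mono le_rfl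
      fun σ' h => ⟨h.1, h.2.2⟩
  · rintro j σ' hF ⟨h5, -⟩
    simp only [Test.Holds, NExpr.eval, hF.nvar 2 (by decide), h5]
    omega
  · rintro j hj σ' hF ⟨h5, h0⟩
    refine Program.LoopFree.runs_le (by simp [Program.LoopFree]) ?_
      (by simp [Program.bound, NExpr.cost, WExpr.cost])
    simp only [Program.run, NExpr.eval]
    refine ⟨by simp [h5], ?_⟩
    simp [WExpr.eval, NExpr.eval, h5, h0, hF.narr, hF.warr, Finset.sum_range_succ,
      h7 _ (h3 j (by omega))]
  · simp [Program.bound, NExpr.cost, Test.cost, WExpr.cost]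
    omega

open NExpr in
/-- Initial distance estimates: zero at the start of the path, its weight everywhere else. -/
def initEstimates : Program :=
  .seq (.seq (.nset 5 (lit 0))
    (.loop (.nlt (var 5) (var 0))
      (.seq (.wput 1 (var 5) (.var 0)) (.nset 5 (add (var 5) (lit 1))))))
    (.wput 1 (get 3 (lit 0)) .zero)

theorem initEstimates_runs (σ : State) (X : ℕ) (hX : σ.nvar 0 ≤ X) :
    Runs initEstimates σ (100 * X + 100) fun σ' =>
      Frame [5] [] [] [1] σ σ' ∧ ∀ v < σ.nvar 0,
        σ'.warr 1 v = if v = σ.narr 3 0 then 0 else σ.wvar 0 := by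
  apply Runs.frame _ (by simp [initEstimates, Program.Within])
  refine (Runs.seq (B₂ := 10) (Runs.initFor (B := 40) (B' := 60 * X + 50)
    (xs := [5]) (as := []) (ys := []) (bs := [1]) (fun i σ' => σ'.nvar 5 = i ∧
      ∀ v < i, σ'.warr 1 v = σ.wvar 0)
    (σ.nvar 0) X hX (by simp [Program.LoopFree])
    (by simp [Program.Within]) (by simp [Program.run, NExpr.eval]) ?_ ?_ ?_)
      ?_).mono (by omega) fun _ h => h
  · rintro j σ' hF ⟨h5, -⟩
    simp [Test.Holds, NExpr.eval, hF.nvar, h5]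
  · rintro j hj σ' hF ⟨h5, h0⟩
    refine Program.LoopFree.runs_le (by simp [Program.LoopFree]) ?_
      (by simp [Program.bound, NExpr.cost, WExpr.cost])
    simp only [Program.run, NExpr.eval]
    refine ⟨by simp [h5], ?_⟩
    intro v hv
    rcases Nat.lt_succ_iff_lt_or_eq.1 hv with h | rfl
    · simp [h5, Function.update_of_ne h.ne, h0 v h]
    · simp [h5, WExpr.eval, hF.wvar]
  · simp [Program.bound, NExpr.cost, Test.cost]
    omega
  · rintro σ' ⟨hF, -, h⟩
    refine Program.LoopFree.runs_le (by simp [Program.LoopFree]) ?_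
      (by simp [Program.bound, NExpr.cost, WExpr.cost])
    simp only [Program.run, NExpr.eval]
    intro v hv
    simp [Function.update_apply, hF.narr, h v hv, WExpr.eval]

open NExpr in
/-- One Bellman-Ford relaxation, along the pair in the variables `5` and `6`. -/
def relax : Program :=
  .cond (.and (.nlt (lit 0) (get 0 (add (get 7 (var 5)) (var 6))))
      (.wlt (.add (.get 1 (var 5)) (.get 0 (add (get 7 (var 5)) (var 6)))) (.get 1 (var 6))))
    (.wput 1 (var 6) (.add (.get 1 (var 5)) (.get 0 (add (get 7 (var 5)) (var 6))))) .skip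

open NExpr in
/-- The rounds of the Bellman-Ford algorithm. -/
def bellmanFord : Program :=
  .seq (.nset 10 (lit 0)) (.loop (.nlt (var 10) (var 0))
    (.seq (.seq (.nset 5 (lit 0)) (.loop (.nlt (var 5) (var 0))
      (.seq (.seq (.nset 6 (lit 0)) (.loop (.nlt (var 6) (var 0))
        (.seq relax (.nset 6 (add (var 6) (lit 1))))))
        (.nset 5 (add (var 5) (lit 1))))))
      (.nset 10 (add (var 10) (lit 1)))))

/-- The effect of relaxing the pair `(u, v)` on the estimates `g`. -/
noncomputable def relaxed (n : ℕ) (A : ℕ → ℕ) (wt : ℕ → ℝ) (u v : ℕ) (g : ℕ → ℝ) : ℕ → ℝ :=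
  open Classical in
  if 0 < A (u * n + v) ∧ g u + wt (u * n + v) < g v then
    Function.update g v (g u + wt (u * n + v)) else g

/-- An invariant of all relaxations holds after the Bellman-Ford algorithm. -/
theorem bellmanFord_runs (σ : State) (X : ℕ) (hX : σ.nvar 0 ≤ X)
    (h7 : ∀ i < σ.nvar 0, σ.narr 7 i = i * σ.nvar 0) (R : ℕ → ℕ → ℕ → (ℕ → ℝ) → Prop)
    (h0 : R 0 0 0 (σ.warr 1))
    (hstep : ∀ r u v g, u < σ.nvar 0 → v < σ.nvar 0 → R r u v g →
      R r u (v + 1) (relaxed (σ.nvar 0) (σ.narr 0) (σ.warr 0) u v g))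
    (hrow : ∀ r u g, R r u (σ.nvar 0) g → R r (u + 1) 0 g)
    (hround : ∀ r g, R r (σ.nvar 0) 0 g → R (r + 1) 0 0 g) :
    Runs bellmanFord σ (X * (X * (X * 60 + 60) + 60) + 60) fun σ' =>
      Frame [5, 6, 10] [] [] [1] σ σ' ∧ R (σ.nvar 0) 0 0 (σ'.warr 1) := by
  refine (Runs.initFor (B := X * (X * 60 + 60) + 40) (fun r σ' => σ'.nvar 10 = r ∧
      R r 0 0 (σ'.warr 1)) (σ.nvar 0) X hX (by simp [Program.LoopFree])
    (by simp [Program.Within, relax]) (by simpa [Program.run, NExpr.eval, WExpr.eval] using h0)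
    ?_ ?_ ?_).mono le_rfl fun σ' h => ⟨h.1, h.2.2⟩
  · rintro j σ' hF ⟨h, -⟩
    simp [Test.Holds, NExpr.eval, hF.nvar, h]
  · rintro r hr σ₁ hF₁ ⟨h10, hR₁⟩
    refine (Runs.seq (B₁ := X * (X * 60 + 60) + 20) (B₂ := 20) (Runs.initFor (B := X * 60 + 40)
      (xs := [5, 6]) (as := []) (ys := []) (bs := [1])
      (fun u σ' => σ'.nvar 5 = u ∧ R r u 0 (σ'.warr 1)) (σ.nvar 0) X hX (by simp [Program.LoopFree])
      (by simp [Program.Within, relax]) (by simpa [Program.run, NExpr.eval, WExpr.eval] using hR₁)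
      ?_ ?_ ?_) ?_).mono (by omega) fun _ h => h
    · rintro j σ' hF ⟨h, -⟩
      simp [Test.Holds, NExpr.eval, hF.nvar, hF₁.nvar, h]
    · rintro u hu σ₂ hF₂ ⟨h5, hR₂⟩
      refine (Runs.seq (B₁ := X * 60 + 20) (B₂ := 20) (Runs.initFor (B := 50)
        (xs := [6]) (as := []) (ys := []) (bs := [1])
        (fun v σ' => σ'.nvar 6 = v ∧ R r u v (σ'.warr 1)) (σ.nvar 0) X hX
        (by simp [Program.LoopFree]) (by simp [Program.Within, relax])
        (by simpa [Program.run, NExpr.eval, WExpr.eval] using hR₂)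
        ?_ ?_ ?_) ?_).mono (by omega) fun _ h => h
      · rintro j σ' hF ⟨h, -⟩
        simp [Test.Holds, NExpr.eval, hF.nvar, hF₂.nvar, hF₁.nvar, h]
      · rintro v hv σ₃ hF₃ ⟨h6, hR₃⟩
        refine Program.LoopFree.runs_le (by simp [Program.LoopFree, relax]) ?_
          (by simp [Program.bound, NExpr.cost, WExpr.cost, Test.cost, relax])
        have e5 : σ₃.nvar 5 = u := (hF₃.nvar 5 (by decide)).trans h5
        have e7 : σ₃.narr 7 u = u * σ.nvar 0 := by
          rw [hF₃.narr 7 (by decide), hF₂.narr 7 (by decide), hF₁.narr 7 (by decide), h7 u hu]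
        have e0 : σ₃.narr 0 = σ.narr 0 := by
          rw [hF₃.narr 0 (by decide), hF₂.narr 0 (by decide), hF₁.narr 0 (by decide)]
        have ew : σ₃.warr 0 = σ.warr 0 := by
          rw [hF₃.warr 0 (by decide), hF₂.warr 0 (by decide), hF₁.warr 0 (by decide)]
        -- The relaxation on the machine computes exactly `relaxed`; everything about graphs is left
        -- to the abstract invariant `R`.
        have := hstep r u v _ hu hv hR₃
        simp only [relax, Program.run, Test.Holds, NExpr.eval, WExpr.eval, e5, h6, e7, e0, ew]
        unfold relaxed at this
        split_ifs at this ⊢ with hc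
        · exact ⟨by simp [h6], by simpa using this⟩
        · exact ⟨by simp [h6], by simpa using this⟩
      · simp [Program.bound, NExpr.cost, Test.cost]
        omega
      · rintro σ' ⟨hF, -, hR⟩
        refine Program.LoopFree.runs_le (by simp [Program.LoopFree]) ?_
          (by simp [Program.bound, NExpr.cost])
        simp only [Program.run, NExpr.eval]
        exact ⟨by simp [hF.nvar, h5], hrow _ _ _ hR⟩
    · simp only [Program.bound, NExpr.cost, Test.cost]
      nlinarith
    · rintro σ' ⟨hF, -, hR⟩
      refine Program.LoopFree.runs_le (by simp [Program.LoopFree]) ?_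
        (by simp [Program.bound, NExpr.cost])
      simp only [Program.run, NExpr.eval]
      exact ⟨by simp [hF.nvar, h10], hround _ _ hR⟩
  · simp only [Program.bound, NExpr.cost, Test.cost]
    nlinarith

end RAM

/-! ### Counting faults in windows and the greedy search. -/

namespace RAM

/-- Whether one of the endpoints `A₁ j`, `A₂ j` has a value of `g` strictly between `lo` and
`hi`. -/
noncomputable def faultIndicator (A₁ A₂ : ℕ → ℕ) (g : ℕ → ℝ) (lo hi : ℝ) (j : ℕ) : ℕ :=
  open Classical in
  if (lo < g (A₁ j) ∧ g (A₁ j) < hi) ∨ (lo < g (A₂ j) ∧ g (A₂ j) < hi) then 1 else 0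

/-- The number of indices `j < f` with `faultIndicator A₁ A₂ g lo hi j = 1`. -/
noncomputable def faultCount (f : ℕ) (A₁ A₂ : ℕ → ℕ) (g : ℕ → ℝ) (lo hi : ℝ) : ℕ :=
  ∑ j ∈ Finset.range f, faultIndicator A₁ A₂ g lo hi j

theorem faultIndicator_self (A₁ A₂ : ℕ → ℕ) (g : ℕ → ℝ) (x : ℝ) (j : ℕ) :
    faultIndicator A₁ A₂ g x x j = 0 := by
  rw [faultIndicator, if_neg]
  rintro (⟨h, h'⟩ | ⟨h, h'⟩) <;> exact lt_asymm h h'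

theorem faultCount_self (f : ℕ) (A₁ A₂ : ℕ → ℕ) (g : ℕ → ℝ) (x : ℝ) :
    faultCount f A₁ A₂ g x x = 0 := by
  simp [faultCount, faultIndicator_self]

/-- The data that the search for the pieces reads: numbers `f`, `m`, `k`, lists of the endpoints
of the faults and of the vertices of the path, and values `g` of the vertices. -/
structure Input (f m k : ℕ) (A₁ A₂ A₃ : ℕ → ℕ) (g : ℕ → ℝ) (σ : State) : Prop where
  nvar_one : σ.nvar 1 = f
  nvar_two : σ.nvar 2 = m
  nvar_three : σ.nvar 3 = k
  narr_one : σ.narr 1 = A₁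
  narr_two : σ.narr 2 = A₂
  narr_three : σ.narr 3 = A₃
  warr_one : σ.warr 1 = g

/-- The default lists cover everything the greedy search assigns and avoid everything it reads as
input; scalar weights are unrestricted, since the input contains none. -/
theorem Input.frame {f m k : ℕ} {A₁ A₂ A₃ : ℕ → ℕ} {g : ℕ → ℝ} {σ σ' : State}
    (h : Input f m k A₁ A₂ A₃ g σ) {xs as ys bs : List ℕ} (hF : Frame xs as ys bs σ σ')
    (hxs : xs ⊆ [4, 5, 6, 7, 8, 9] := by decide) (has : as ⊆ [4, 5, 6, 8] := by decide)
    (hbs : bs ⊆ [] := by decide) :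
    Input f m k A₁ A₂ A₃ g σ' := by
  have hF := hF.mono hxs has (List.Subset.refl ys) hbs
  exact ⟨(hF.nvar 1 (by decide)).trans h.1, (hF.nvar 2 (by decide)).trans h.2,
    (hF.nvar 3 (by decide)).trans h.3, (hF.narr 1 (by decide)).trans h.4,
    (hF.narr 2 (by decide)).trans h.5, (hF.narr 3 (by decide)).trans h.6,
    (hF.warr 1 (by decide)).trans h.7⟩

/-- Test whether a vertex has a value between `w₂ - w₁` and `w₄ - w₃`. -/
def betweenTest (x : NExpr) : Test :=
  -- Weights cannot be subtracted, so both bounds of the window are given as differences and the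
  -- subtrahends are moved to the other side.
  .and (.wlt (.var 2) (.add (.get 1 x) (.var 1))) (.wlt (.add (.get 1 x) (.var 3)) (.var 4))

open NExpr in
/-- Mark the faults with an endpoint in the window in array `8`, and add up `k` for each. -/
def markFaults : Program :=
  .seq (.seq (.nset 6 (lit 0)) (.nset 7 (lit 0)))
    (.loop (.nlt (var 6) (var 1))
      (.seq (.cond (.and (.not (betweenTest (get 1 (var 6)))) (.not (betweenTest (get 2 (var 6)))))
          (.nput 8 (var 6) (lit 0))
          (.seq (.nput 8 (var 6) (lit 1)) (.nset 7 (add (var 7) (var 3)))))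
        (.nset 6 (add (var 6) (lit 1)))))

section Greedy

variable {f m k : ℕ} {A₁ A₂ A₃ : ℕ → ℕ} {g : ℕ → ℝ}

theorem markFaults_runs {σ : State} (hσ : Input f m k A₁ A₂ A₃ g σ) {X : ℕ} (hX : f ≤ X) {lo hi : ℝ}
    (hlo : lo = σ.wvar 2 - σ.wvar 1) (hhi : hi = σ.wvar 4 - σ.wvar 3) :
    Runs markFaults σ (200 * X + 200) fun σ' =>
      Frame [6, 7] [8] [] [] σ σ' ∧ σ'.nvar 7 = k * faultCount f A₁ A₂ g lo hi ∧
        ∀ j < f, σ'.narr 8 j = faultIndicator A₁ A₂ g lo hi j := by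
  refine (Runs.initFor (B := 90) (fun i σ' => σ'.nvar 6 = i ∧
      σ'.nvar 7 = k * faultCount i A₁ A₂ g lo hi ∧
        ∀ j < i, σ'.narr 8 j = faultIndicator A₁ A₂ g lo hi j) f X hX (by simp [Program.LoopFree])
    (by simp [Program.Within]) (by simp [Program.run, NExpr.eval, faultCount]) ?_ ?_ ?_).mono le_rfl
      fun σ' h => ⟨h.1, h.2.2⟩
  · rintro j σ' hF ⟨h, -⟩
    simp [Test.Holds, NExpr.eval, hF.nvar, hσ.nvar_one, h]
  · rintro j hj σ' hF ⟨h6, h7, h8⟩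
    refine Program.LoopFree.runs_le (by simp [Program.LoopFree]) ?_
      (by simp [Program.bound, NExpr.cost, WExpr.cost, Test.cost, betweenTest])
    have hI := hσ.frame hF
    have hiff : ∀ x : ℕ, (σ'.wvar 2 < g x + σ'.wvar 1 ∧ g x + σ'.wvar 3 < σ'.wvar 4) ↔
        (lo < g x ∧ g x < hi) := by
      intro x
      rw [hlo, hhi, hF.wvar 1 (by decide), hF.wvar 2 (by decide), hF.wvar 3 (by decide),
        hF.wvar 4 (by decide), sub_lt_iff_lt_add, lt_sub_iff_add_lt]
    have hnew : ∀ c : ℕ, c = faultIndicator A₁ A₂ g lo hi j → ∀ i < j + 1,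
        Function.update (σ'.narr 8) j c i = faultIndicator A₁ A₂ g lo hi i := by
      intro c hc i hi
      rcases Nat.lt_succ_iff_lt_or_eq.1 hi with h | rfl
      · simp [Function.update_of_ne h.ne, h8 i h]
      · simp [hc]
    have hcount : faultCount (j + 1) A₁ A₂ g lo hi =
        faultCount j A₁ A₂ g lo hi + faultIndicator A₁ A₂ g lo hi j := Finset.sum_range_succ _ _
    simp only [Program.run, betweenTest, Test.Holds, NExpr.eval, WExpr.eval, h6, hI.narr_one,
      hI.narr_two, hI.warr_one, hiff, ← not_or]
    split_ifs with hc
    · have hind : faultIndicator A₁ A₂ g lo hi j = 1 := if_pos hc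
      exact ⟨by simp [h6], by simp [h7, hcount, hind, hI.nvar_three, mul_add],
        by simpa using hnew 1 hind.symm⟩
    · have hind : faultIndicator A₁ A₂ g lo hi j = 0 := if_neg hc
      exact ⟨by simp [h6], by simp [h7, hcount, hind], by simpa using hnew 0 hind.symm⟩
  · simp [Program.bound, NExpr.cost, Test.cost]
    omega

open NExpr in
/-- Select the left window of the interval given by the variables `8` and `5`. -/
def setLeft : Program :=
  .seq (.seq (.wset 1 (.get 1 (get 3 (var 5))))
      (.wset 2 (.add (.get 1 (get 3 (var 8))) (.get 1 (get 3 (var 8))))))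
    (.seq (.wset 3 .zero) (.wset 4 (.get 1 (get 3 (var 5)))))

open NExpr in
/-- Select the right window of the interval given by the variables `8` and `5`. -/
def setRight : Program :=
  .seq (.seq (.wset 1 .zero) (.wset 2 (.get 1 (get 3 (var 8)))))
    (.seq (.wset 3 (.get 1 (get 3 (var 8))))
      (.wset 4 (.add (.get 1 (get 3 (var 5))) (.get 1 (get 3 (var 5))))))

theorem setLeft_markFaults_runs {σ : State} (hσ : Input f m k A₁ A₂ A₃ g σ) {X : ℕ} (hX : f ≤ X)
    {a b : ℝ} (ha : a = g (A₃ (σ.nvar 8))) (hb : b = g (A₃ (σ.nvar 5))) :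
    Runs (.seq setLeft markFaults) σ (200 * X + 250) fun σ' =>
      Frame [6, 7] [8] [1, 2, 3, 4] [] σ σ' ∧
        σ'.nvar 7 = k * faultCount f A₁ A₂ g (2 * a - b) b ∧
        ∀ j < f, σ'.narr 8 j = faultIndicator A₁ A₂ g (2 * a - b) b j := by
  refine (Runs.seq (B₁ := 50) (B₂ := 200 * X + 200) (R := fun σ' => Frame [6, 7] [8] [1, 2, 3, 4] [] σ σ' ∧
      b = σ'.wvar 4 - σ'.wvar 3 ∧ 2 * a - b = σ'.wvar 2 - σ'.wvar 1)
    (Runs.frame (Program.LoopFree.runs_le (by simp [setLeft, Program.LoopFree]) ?_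
      (by simp [setLeft, Program.bound, NExpr.cost, WExpr.cost]))
      (by simp [setLeft, Program.Within])) ?_).mono (by omega) fun _ h => h
  · simp [setLeft, Program.run, WExpr.eval, NExpr.eval, hσ.narr_three, hσ.warr_one, ha, hb,
      two_mul]
  · rintro σ₁ ⟨hF, h1, h2⟩
    exact (markFaults_runs (hσ.frame hF) hX h2 h1).mono le_rfl fun σ' h =>
      ⟨hF.trans (h.1.mono (by decide) (by decide) (by decide) (by decide)), h.2⟩

theorem setRight_markFaults_runs {σ : State} (hσ : Input f m k A₁ A₂ A₃ g σ) {X : ℕ} (hX : f ≤ X)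
    {a b : ℝ} (ha : a = g (A₃ (σ.nvar 8))) (hb : b = g (A₃ (σ.nvar 5))) :
    Runs (.seq setRight markFaults) σ (200 * X + 250) fun σ' =>
      Frame [6, 7] [8] [1, 2, 3, 4] [] σ σ' ∧
        σ'.nvar 7 = k * faultCount f A₁ A₂ g a (2 * b - a) ∧
        ∀ j < f, σ'.narr 8 j = faultIndicator A₁ A₂ g a (2 * b - a) j := by
  refine (Runs.seq (B₁ := 50) (B₂ := 200 * X + 200) (R := fun σ' => Frame [6, 7] [8] [1, 2, 3, 4] [] σ σ' ∧
      2 * b - a = σ'.wvar 4 - σ'.wvar 3 ∧ a = σ'.wvar 2 - σ'.wvar 1)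
    (Runs.frame (Program.LoopFree.runs_le (by simp [setRight, Program.LoopFree]) ?_
      (by simp [setRight, Program.bound, NExpr.cost, WExpr.cost]))
      (by simp [setRight, Program.Within])) ?_).mono (by omega) fun _ h => h
  · simp [setRight, Program.run, WExpr.eval, NExpr.eval, hσ.narr_three, hσ.warr_one, ha, hb,
      two_mul]
  · rintro σ₁ ⟨hF, h1, h2⟩
    exact (markFaults_runs (hσ.frame hF) hX h2 h1).mono le_rfl fun σ' h =>
      ⟨hF.trans (h.1.mono (by decide) (by decide) (by decide) (by decide)), h.2⟩

open NExpr in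
/-- Start a new piece at the current vertex. -/
def startPiece : Program :=
  .seq (.seq (.nset 4 (add (var 4) (lit 1))) (.nset 9 (add (var 9) (var 1))))
    (.seq (.nset 8 (var 5)) (.nput 4 (var 4) (get 3 (var 5))))

open NExpr in
/-- Find a window with few faults for the current piece, extended to the current vertex; if there
is none, start a new piece. -/
def selectWindow : Program :=
  -- Variable `7` holds `k` times the count, so this tests whether the count exceeds `f / k` without
  -- a division.
  .seq (.seq setLeft markFaults) (.cond (.nlt (var 1) (var 7))
    (.seq (.seq setRight markFaults) (.cond (.nlt (var 1) (var 7))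
      -- The new piece is a single vertex, so its window is empty and the last call only clears the
      -- marks.
      (.seq startPiece (.seq setLeft markFaults)) .skip)) .skip)

theorem selectWindow_runs {σ : State} (hσ : Input f m k A₁ A₂ A₃ g σ) {X : ℕ} (hX : f ≤ X)
    {a b : ℝ} (ha : a = g (A₃ (σ.nvar 8))) (hb : b = g (A₃ (σ.nvar 5))) :
    Runs selectWindow σ (600 * X + 900) fun σ' =>
      Frame [4, 6, 7, 8, 9] [4, 8] [1, 2, 3, 4] [] σ σ' ∧ ∃ lo hi : ℝ,
        (∀ j < f, σ'.narr 8 j = faultIndicator A₁ A₂ g lo hi j) ∧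
        ((σ'.nvar 4 = σ.nvar 4 ∧ σ'.nvar 8 = σ.nvar 8 ∧ σ'.nvar 9 = σ.nvar 9 ∧
            σ'.narr 4 = σ.narr 4 ∧ k * faultCount f A₁ A₂ g lo hi ≤ f ∧
            ((lo = 2 * a - b ∧ hi = b) ∨ (lo = a ∧ hi = 2 * b - a))) ∨
          (σ'.nvar 4 = σ.nvar 4 + 1 ∧ σ'.nvar 8 = σ.nvar 5 ∧ σ'.nvar 9 = σ.nvar 9 + f ∧
            σ'.narr 4 = Function.update (σ.narr 4) (σ.nvar 4 + 1) (A₃ (σ.nvar 5)) ∧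
            f < k * faultCount f A₁ A₂ g (2 * a - b) b ∧
            f < k * faultCount f A₁ A₂ g a (2 * b - a) ∧ lo = b ∧ hi = b)) := by
  apply Runs.frame _ (by simp [selectWindow, setLeft, setRight, startPiece, markFaults,
    Program.Within])
  refine (Runs.seq (B₂ := 400 * X + 600) (setLeft_markFaults_runs hσ hX ha hb) ?_).mono
    (by omega) fun _ h => h
  rintro σ₁ ⟨hF₁, h7, h8⟩
  have hσ₁ := hσ.frame hF₁
  refine (Runs.cond (B := 400 * X + 590) (fun hc => ?_) (fun hc => ?_)).mono
    (by simp only [Test.cost, NExpr.cost]; omega) fun _ h => h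
  · simp only [Test.Holds, NExpr.eval, hσ₁.nvar_one, h7] at hc
    refine (Runs.seq (B₂ := 200 * X + 340) (setRight_markFaults_runs (a := a) (b := b) hσ₁ hX
      (by rw [hF₁.nvar 8 (by decide), ha]) (by rw [hF₁.nvar 5 (by decide), hb])) ?_).mono
      (by omega) fun _ h => h
    rintro σ₂ ⟨hF₂, h7', h8'⟩
    have hσ₂ := hσ₁.frame hF₂
    have hF := hF₁.trans hF₂
    refine (Runs.cond (B := 200 * X + 330) (fun hc' => ?_) (fun hc' => ?_)).mono
      (by simp only [Test.cost, NExpr.cost]; omega) fun _ h => h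
    · simp only [Test.Holds, NExpr.eval, hσ₂.nvar_one, h7'] at hc'
      refine (Runs.seq (B₁ := 50) (B₂ := 200 * X + 250)
        (R := fun σ' => Frame [4, 8, 9] [4] [] [] σ₂ σ' ∧
          σ'.nvar 4 = σ.nvar 4 + 1 ∧ σ'.nvar 8 = σ.nvar 5 ∧ σ'.nvar 9 = σ.nvar 9 + f ∧
          σ'.narr 4 = Function.update (σ.narr 4) (σ.nvar 4 + 1) (A₃ (σ.nvar 5)))
        (Runs.frame (Program.LoopFree.runs_le (by simp [startPiece, Program.LoopFree]) ?_
        (by simp [startPiece, Program.bound, NExpr.cost])) (by simp [startPiece, Program.Within]))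
        ?_).mono (by omega) fun _ h => h
      · simp [startPiece, Program.run, NExpr.eval, hF.nvar, hF.narr, hσ.nvar_one,
          hσ.narr_three]
      · rintro σ₃ ⟨hF₃, e4, e8, e9, e4'⟩
        have e5 : σ₃.nvar 5 = σ.nvar 5 := by rw [hF₃.nvar 5 (by decide), hF.nvar 5 (by decide)]
        refine (setLeft_markFaults_runs (a := b) (b := b) (hσ₂.frame hF₃) hX (by rw [e8, hb])
          (by rw [e5, hb])).mono (by omega) ?_
        rintro σ₄ ⟨hF₄, -, h8''⟩
        refine ⟨b, b, ?_, Or.inr ⟨?_, ?_, ?_, ?_, hc, hc', rfl, rfl⟩⟩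
        · rwa [show 2 * b - b = b by ring] at h8''
        · rw [hF₄.nvar 4 (by decide), e4]
        · rw [hF₄.nvar 8 (by decide), e8]
        · rw [hF₄.nvar 9 (by decide), e9]
        · rw [hF₄.narr 4 (by decide), e4']
    · simp only [Test.Holds, NExpr.eval, hσ₂.nvar_one, h7', not_lt] at hc'
      refine Program.LoopFree.runs_le (by simp [Program.LoopFree]) ?_ (by simp [Program.bound])
      exact ⟨a, 2 * b - a, h8', Or.inl ⟨hF.nvar 4 (by decide), hF.nvar 8 (by decide),
        hF.nvar 9 (by decide), hF.narr 4 (by decide), hc', Or.inr ⟨rfl, rfl⟩⟩⟩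
  · simp only [Test.Holds, NExpr.eval, hσ₁.nvar_one, h7, not_lt] at hc
    refine Program.LoopFree.runs_le (by simp [Program.LoopFree]) ?_ (by simp [Program.bound])
    exact ⟨2 * a - b, b, h8, Or.inl ⟨hF₁.nvar 4 (by decide), hF₁.nvar 8 (by decide),
      hF₁.nvar 9 (by decide), hF₁.narr 4 (by decide), hc, Or.inl ⟨rfl, rfl⟩⟩⟩

open NExpr in
/-- Copy the marks into the output row that starts at the variable `9`. -/
def copyMarks : Program :=
  .seq (.nset 6 (lit 0)) (.loop (.nlt (var 6) (var 1))
    (.seq (.nput 6 (add (var 9) (var 6)) (get 8 (var 6))) (.nset 6 (add (var 6) (lit 1)))))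

theorem copyMarks_runs {σ : State} (hσ : Input f m k A₁ A₂ A₃ g σ) {X : ℕ} (hX : f ≤ X) :
    Runs copyMarks σ (100 * X + 100) fun σ' =>
      Frame [6] [6] [] [] σ σ' ∧ (∀ j < f, σ'.narr 6 (σ.nvar 9 + j) = σ.narr 8 j) ∧
        ∀ x < σ.nvar 9, σ'.narr 6 x = σ.narr 6 x := by
  refine (Runs.initFor (B := 40) (fun i σ' => σ'.nvar 6 = i ∧
      (∀ j < i, σ'.narr 6 (σ.nvar 9 + j) = σ.narr 8 j) ∧
        ∀ x < σ.nvar 9, σ'.narr 6 x = σ.narr 6 x) f X hX (by simp [Program.LoopFree])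
    (by simp [Program.Within]) (by simp [Program.run, NExpr.eval]) ?_ ?_ ?_).mono le_rfl
      fun σ' h => ⟨h.1, h.2.2⟩
  · rintro j σ' hF ⟨h, -⟩
    simp [Test.Holds, NExpr.eval, hF.nvar, hσ.nvar_one, h]
  · rintro j hj σ' hF ⟨h6, h1, h2⟩
    refine Program.LoopFree.runs_le (by simp [Program.LoopFree]) ?_
      (by simp [Program.bound, NExpr.cost])
    simp only [Program.run, NExpr.eval]
    refine ⟨by simp [h6], ?_, ?_⟩
    · intro i hi
      rcases Nat.lt_succ_iff_lt_or_eq.1 hi with h | rfl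
      · simp [h6, hF.nvar, h1 i h, h.ne]
      · simp [h6, hF.nvar, hF.narr]
    · intro x hx
      have : x ≠ σ.nvar 9 + j := by omega
      simp [h6, hF.nvar, h2 x hx, this]
  · simp [Program.bound, NExpr.cost, Test.cost]
    omega

/-- A division of the positions `0, …, i` into intervals `st j, …, en j` for `j ≤ q`, each with a
window of small count, that is greedy: both windows of every interval from one start to the next
have a large count. -/
structure GreedyDivision (f k : ℕ) (pos : ℕ → ℝ) (cnt : ℝ → ℝ → ℕ) (i q : ℕ) (st en : ℕ → ℕ)
    (lo hi : ℕ → ℝ) : Prop where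
  start : st 0 = 0
  le : ∀ j ≤ q, st j ≤ en j
  link : ∀ j < q, st (j + 1) = en j + 1
  last : en q = i
  small : ∀ j ≤ q, k * cnt (lo j) (hi j) ≤ f
  good : ∀ j ≤ q, (lo j = 2 * pos (st j) - pos (en j) ∧ hi j = pos (en j)) ∨
    (lo j = pos (st j) ∧ hi j = 2 * pos (en j) - pos (st j))
  bad : ∀ j < q, f < k * cnt (2 * pos (st j) - pos (st (j + 1))) (pos (st (j + 1))) ∧
    f < k * cnt (pos (st j)) (2 * pos (st (j + 1)) - pos (st j))

variable {pos : ℕ → ℝ} {cnt : ℝ → ℝ → ℕ} {i q : ℕ} {st en : ℕ → ℕ} {lo hi : ℕ → ℝ}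

/-- Only the end and the window of the last piece change; `bad` speaks of starts alone and is
untouched. -/
theorem GreedyDivision.extend (h : GreedyDivision f k pos cnt i q st en lo hi) {l u : ℝ}
    (hs : k * cnt l u ≤ f)
    (hlu : (l = 2 * pos (st q) - pos (i + 1) ∧ u = pos (i + 1)) ∨
      (l = pos (st q) ∧ u = 2 * pos (i + 1) - pos (st q))) :
    GreedyDivision f k pos cnt (i + 1) q st (Function.update en q (i + 1))
      (Function.update lo q l) (Function.update hi q u) := by
  refine ⟨h.start, ?_, ?_, by simp, ?_, ?_, h.bad⟩
  · intro j hj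
    rcases hj.lt_or_eq with hj' | rfl
    · simpa [hj'.ne] using h.le j hj
    · have := h.le j le_rfl
      have := h.last
      rw [Function.update_self]
      omega
  · intro j hj
    simpa [hj.ne] using h.link j hj
  · intro j hj
    rcases hj.lt_or_eq with hj' | rfl
    · simpa [hj'.ne] using h.small j hj
    · simpa using hs
  · intro j hj
    rcases hj.lt_or_eq with hj' | rfl
    · simpa [hj'.ne] using h.good j hj
    · simpa using hlu

/-- The failure of both windows for the extended piece is recorded as `bad` for the interval up to
the new start. The new one-vertex piece receives the degenerate window at its own position. -/
theorem GreedyDivision.newPiece (h : GreedyDivision f k pos cnt i q st en lo hi)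
    (hs : k * cnt (pos (i + 1)) (pos (i + 1)) ≤ f)
    (hl : f < k * cnt (2 * pos (st q) - pos (i + 1)) (pos (i + 1)))
    (hr : f < k * cnt (pos (st q)) (2 * pos (i + 1) - pos (st q))) :
    GreedyDivision f k pos cnt (i + 1) (q + 1) (Function.update st (q + 1) (i + 1))
      (Function.update en (q + 1) (i + 1)) (Function.update lo (q + 1) (pos (i + 1)))
      (Function.update hi (q + 1) (pos (i + 1))) := by
  refine ⟨by simp [h.start], ?_, ?_, by simp, ?_, ?_, ?_⟩
  · intro j hj
    rcases hj.lt_or_eq with hj' | rfl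
    · simpa [hj'.ne] using h.le j (by omega)
    · simp
  · intro j hj
    rcases (Nat.lt_succ_iff.1 hj).lt_or_eq with hj' | rfl
    · simpa [hj.ne, hj'.ne] using h.link j hj'
    · simp [h.last]
  · intro j hj
    rcases hj.lt_or_eq with hj' | rfl
    · simpa [hj'.ne] using h.small j (by omega)
    · simpa using hs
  · intro j hj
    rcases hj.lt_or_eq with hj' | rfl
    · simpa [hj'.ne] using h.good j (by omega)
    · simp [two_mul]
  · intro j hj
    rcases (Nat.lt_succ_iff.1 hj).lt_or_eq with hj' | rfl
    · simpa [hj.ne, hj'.ne] using h.bad j hj'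
    · simpa using ⟨hl, hr⟩

open NExpr in
/-- Divide the path greedily into pieces. -/
def dividePath : Program :=
  .seq (.seq (.seq (.nset 5 (lit 0)) (.nset 4 (lit 0)))
      (.seq (.seq (.nset 8 (lit 0)) (.nset 9 (lit 0)))
        (.seq (.nput 4 (lit 0) (get 3 (lit 0))) (.nput 5 (lit 0) (get 3 (lit 0))))))
    (.loop (.nlt (add (var 5) (lit 1)) (var 2))
      (.seq (.nset 5 (add (var 5) (lit 1)))
        (.seq selectWindow (.seq (.nput 5 (var 4) (get 3 (var 5))) copyMarks))))

/-- The memory `σ` describes the first `q + 1` pieces. -/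
structure HoldsPieces (f : ℕ) (A₁ A₂ A₃ : ℕ → ℕ) (g : ℕ → ℝ) (q : ℕ) (st en : ℕ → ℕ)
    (lo hi : ℕ → ℝ) (σ : State) : Prop where
  nvar_four : σ.nvar 4 = q
  narr_four : ∀ j ≤ q, σ.narr 4 j = A₃ (st j)
  narr_five : ∀ j ≤ q, σ.narr 5 j = A₃ (en j)
  narr_six : ∀ j ≤ q, ∀ l < f,
    σ.narr 6 (j * f + l) = faultIndicator A₁ A₂ g (lo j) (hi j) l

theorem dividePath_runs {σ : State} (hσ : Input f m k A₁ A₂ A₃ g σ) {X : ℕ} (hX : f ≤ X)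
    (hm : m ≤ X) (h6 : ∀ j, σ.narr 6 j = 0) :
    Runs dividePath σ (X * (1000 * X + 1500) + 200) fun σ' => ∃ q st en lo hi,
      GreedyDivision f k (fun i => g (A₃ i)) (faultCount f A₁ A₂ g) (m - 1) q st en lo hi ∧
      HoldsPieces f A₁ A₂ A₃ g q st en lo hi σ' := by
  refine (Runs.initFor (B := 1000 * X + 1450) (xs := [4, 5, 6, 7, 8, 9]) (as := [4, 5, 6, 8])
    (ys := [1, 2, 3, 4]) (bs := []) (fun i σ' => σ'.nvar 5 = i ∧ ∃ q st en lo hi,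
      GreedyDivision f k (fun i => g (A₃ i)) (faultCount f A₁ A₂ g) i q st en lo hi ∧
      HoldsPieces f A₁ A₂ A₃ g q st en lo hi σ' ∧ σ'.nvar 8 = st q ∧ σ'.nvar 9 = q * f)
    (m - 1) X (by omega) (by simp [Program.LoopFree])
    (by simp [selectWindow, setLeft, setRight, startPiece, markFaults, copyMarks, Program.Within])
    ?_ ?_ ?_ ?_).mono le_rfl ?_
  -- The first piece is the first vertex with an empty window. Its indicator row is not written
  -- before the loop, which is why array `6` has to start at zero.
  · refine ⟨by simp [Program.run, NExpr.eval], 0, fun _ => 0, fun _ => 0, fun _ => g (A₃ 0),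
      fun _ => g (A₃ 0), ?_, ?_, by simp [Program.run, NExpr.eval],
      by simp [Program.run, NExpr.eval]⟩
    · constructor <;> simp [faultCount_self, two_mul]
    · constructor <;> simp [Program.run, NExpr.eval, hσ.narr_three, h6, faultIndicator_self]
  · rintro j σ' hF ⟨h, -⟩
    have := hσ.frame hF (by decide) (by decide)
    simp only [Test.Holds, NExpr.eval, this.nvar_two, h]
    omega
  · rintro i hi σ₀ hF₀ ⟨h5, q, st, en, lo, hi, hdiv, hout, hst, hbase⟩
    have hσ₀ := hσ.frame hF₀
    refine (Runs.seq (B₁ := 10) (B₂ := 1000 * X + 1400)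
      (R := fun σ' => Frame [5] [] [] [] σ₀ σ' ∧ σ'.nvar 5 = i + 1)
      (Runs.frame (Program.LoopFree.runs_le (by simp [Program.LoopFree])
        (by simp [Program.run, NExpr.eval, h5]) (by simp [Program.bound, NExpr.cost]))
        (by simp [Program.Within])) ?_).mono (by omega) fun _ h => h
    rintro σ₁ ⟨hF₁, h5₁⟩
    have hσ₁ := hσ₀.frame hF₁
    have h8₁ : σ₁.nvar 8 = st q := by rw [hF₁.nvar 8 (by decide), hst]
    refine (Runs.seq (B₂ := 100 * X + 150) (selectWindow_runs hσ₁ hX rfl rfl) ?_).mono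
      (by omega) fun _ h => h
    rintro σ₂ ⟨hF₂, l, u, h8₂, hcase⟩
    have hσ₂ := hσ₁.frame hF₂
    refine (Runs.seq (B₁ := 20) (B₂ := 100 * X + 100)
      (R := fun σ' => Frame [] [5] [] [] σ₂ σ' ∧
        σ'.narr 5 = Function.update (σ₀.narr 5) (σ₂.nvar 4) (A₃ (i + 1)))
      (Runs.frame (Program.LoopFree.runs_le (by simp [Program.LoopFree])
        (by simp [Program.run, NExpr.eval, hσ₂.narr_three, hF₂.nvar, h5₁, hF₂.narr, hF₁.narr])
        (by simp [Program.bound, NExpr.cost]))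
        (by simp [Program.Within])) ?_).mono (by omega) fun _ h => h
    rintro σ₃ ⟨hF₃, h5₃⟩
    refine (copyMarks_runs (hσ₂.frame hF₃) hX).mono le_rfl ?_
    rintro σ₄ ⟨hF₄, hnew, hold⟩
    have e5 : σ₄.nvar 5 = i + 1 := by
      rw [hF₄.nvar 5 (by decide), hF₃.nvar 5 (by decide), hF₂.nvar 5 (by decide), h5₁]
    have e4 : σ₄.nvar 4 = σ₂.nvar 4 := by rw [hF₄.nvar 4 (by decide), hF₃.nvar 4 (by decide)]
    have e8 : σ₄.nvar 8 = σ₂.nvar 8 := by rw [hF₄.nvar 8 (by decide), hF₃.nvar 8 (by decide)]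
    have e9 : σ₄.nvar 9 = σ₂.nvar 9 := by rw [hF₄.nvar 9 (by decide), hF₃.nvar 9 (by decide)]
    have a4 : σ₄.narr 4 = σ₂.narr 4 := by rw [hF₄.narr 4 (by decide), hF₃.narr 4 (by decide)]
    have a5 : σ₄.narr 5 = Function.update (σ₀.narr 5) (σ₂.nvar 4) (A₃ (i + 1)) := by
      rw [hF₄.narr 5 (by decide), h5₃]
    have a6 : σ₃.narr 6 = σ₀.narr 6 := by
      rw [hF₃.narr 6 (by decide), hF₂.narr 6 (by decide), hF₁.narr 6 (by decide)]
    rw [hF₃.nvar 9 (by decide), hF₃.narr 8 (by decide)] at hnew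
    rw [hF₃.nvar 9 (by decide), a6] at hold
    -- All entries of earlier output rows lie below the base of the current row, so rewriting the
    -- current row preserves them.
    have hrow : ∀ j j' l, l < f → j < j' → j * f + l < j' * f := by
      intro j j' l hl hj
      have := Nat.mul_le_mul_right f (Nat.succ_le_of_lt hj)
      rw [Nat.succ_mul] at this
      omega
    rw [hF₁.nvar 4 (by decide), hF₁.nvar 9 (by decide), hF₁.narr 4 (by decide), h8₁, h5₁,
      hout.nvar_four, hbase] at hcase
    refine ⟨e5, ?_⟩
    rcases hcase with ⟨c4, c8, c9, ca4, hsmall, hgood⟩ | ⟨c4, c8, c9, ca4, hl, hr, rfl, rfl⟩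
    · refine ⟨q, st, _, _, _, hdiv.extend hsmall hgood, ⟨?_, ?_, ?_, ?_⟩, ?_, ?_⟩
      · rw [e4, c4]
      · intro j hj
        rw [a4, ca4, hout.narr_four j hj]
      · intro j hj
        rw [a5, c4]
        rcases hj.lt_or_eq with hj' | rfl
        · simpa [hj'.ne] using hout.narr_five j hj
        · simp
      · intro j hj x hx
        rcases hj.lt_or_eq with hj' | rfl
        · rw [hold _ (by rw [c9]; exact hrow j q x hx hj'), hout.narr_six j hj x hx]
          simp [hj'.ne]
        · rw [← c9, hnew x hx, h8₂ x hx]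
          simp
      · rw [e8, c8]
      · rw [e9, c9]
    · refine ⟨q + 1, _, _, _, _, hdiv.newPiece (by simp [faultCount_self]) hl hr,
        ⟨?_, ?_, ?_, ?_⟩, ?_, ?_⟩
      · rw [e4, c4]
      · intro j hj
        rw [a4, ca4]
        rcases hj.lt_or_eq with hj' | rfl
        · simpa [hj'.ne] using hout.narr_four j (by omega)
        · simp
      · intro j hj
        rw [a5, c4]
        rcases hj.lt_or_eq with hj' | rfl
        · simpa [hj'.ne] using hout.narr_five j (by omega)
        · simp
      · intro j hj x hx
        have hb9 : σ₂.nvar 9 = (q + 1) * f := by rw [c9, Nat.succ_mul]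
        rcases hj.lt_or_eq with hj' | rfl
        · rw [hold _ (by rw [hb9]; exact hrow j (q + 1) x hx hj'),
            hout.narr_six j (by omega) x hx]
          simp [hj'.ne]
        · rw [← hb9, hnew x hx, h8₂ x hx]
          simp
      · rw [e8, c8]
        simp
      · rw [e9, c9, Nat.succ_mul]
  · simp only [Program.bound, NExpr.cost, Test.cost]
    nlinarith
  · rintro σ' ⟨-, -, q, st, en, lo, hi, hdiv, hout, -⟩
    exact ⟨q, st, en, lo, hi, hdiv, hout⟩

end Greedy

end RAM

/-! ### Correctness of the Bellman-Ford estimates. -/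

namespace Restoration

open SimpleGraph

section Estimates

variable {n : ℕ} {H : SimpleGraph (Fin n)} {w : Sym2 (Fin n) → ℝ} {s : Fin n} {D : ℝ}

/-- The invariant of the Bellman-Ford algorithm with initial estimate `D`: in round `r`, all pairs
before `(u, v)` have been relaxed. -/
structure Estimates (H : SimpleGraph (Fin n)) (w : Sym2 (Fin n) → ℝ) (s : Fin n) (D : ℝ)
    (r u v : ℕ) (g : ℕ → ℝ) : Prop where
  lower : ∀ x : Fin n, D ≤ g x ∨ ∃ p : H.Walk s x, walkWeight w p ≤ g x
  le : ∀ x : Fin n, g x ≤ D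
  upper : ∀ (x : Fin n) (p : H.Walk s x), p.length ≤ r → g x ≤ walkWeight w p
  step : ∀ x y : Fin n, H.Adj x y → ((x : ℕ) < u ∨ (x : ℕ) = u ∧ (y : ℕ) < v) →
    ∀ p : H.Walk s x, p.length ≤ r → g y ≤ walkWeight w p + w s(x, y)

theorem Estimates.init (hD : 0 ≤ D) {g : ℕ → ℝ}
    (hg : ∀ x : Fin n, g x = if (x : ℕ) = s then 0 else D) : Estimates H w s D 0 0 0 g := by
  refine ⟨fun x => ?_, fun x => ?_, fun x p hp => ?_, fun x y _ h => by omega⟩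
  · by_cases hx : x = s
    · subst hx
      exact Or.inr ⟨Walk.nil, by simp [walkWeight_nil, hg]⟩
    · exact Or.inl (by rw [hg, if_neg (by simpa [Fin.ext_iff] using hx)])
  · rw [hg]
    split_ifs
    exacts [hD, le_rfl]
  · cases p with
    | nil => simp [walkWeight_nil, hg]
    | cons h p => simp at hp

theorem Estimates.row {r u : ℕ} {g : ℕ → ℝ} (h : Estimates H w s D r u n g) :
    Estimates H w s D r (u + 1) 0 g :=
  ⟨h.lower, h.le, h.upper, fun x y hxy hlt => h.step x y hxy (by have := y.2; omega)⟩

theorem walkWeight_concat {u v x : Fin n} (p : H.Walk u v) (h : H.Adj v x) :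
    walkWeight w (p.concat h) = walkWeight w p + w s(v, x) := by
  simp [Walk.concat_eq_append, walkWeight_append, walkWeight_cons, walkWeight_nil]

/-- A walk with `r + 1` edges is a walk with `r` edges followed by an edge that was relaxed in this
round. -/
theorem Estimates.round {r : ℕ} {g : ℕ → ℝ} (h : Estimates H w s D r n 0 g) :
    Estimates H w s D (r + 1) 0 0 g := by
  refine ⟨h.lower, h.le, fun x p hp => ?_, fun x y _ h => by omega⟩
  rcases hp.lt_or_eq with hp | hp
  · exact h.upper x p (by omega)
  · obtain ⟨y, z, p, e, r', rfl, hl⟩ := exists_append_cons p r (by omega)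
    simp only [Walk.length_append, Walk.length_cons] at hp
    cases r' with
    | nil =>
      rw [walkWeight_append, walkWeight_cons, walkWeight_nil, add_zero]
      exact h.step y _ e (Or.inl y.2) p hl.le
    | cons _ _ =>
      rw [Walk.length_cons] at hp
      omega

/-- Estimates only decrease, so upper bounds survive updates in place. A new value is either
witnessed by a walk prolonged by one edge or still at least `D`. -/
theorem Estimates.relaxed {A : ℕ → ℕ} {wt : ℕ → ℝ}
    (hA : ∀ x y : Fin n, 0 < A (x * n + y) ↔ H.Adj x y)
    (hwt : ∀ x y : Fin n, H.Adj x y → wt (x * n + y) = w s(x, y))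
    (hw : ∀ e ∈ H.edgeSet, 0 ≤ w e) {r u v : ℕ} (hu : u < n) (hv : v < n) {g : ℕ → ℝ}
    (h : Estimates H w s D r u v g) :
    Estimates H w s D r u (v + 1) (RAM.relaxed n A wt u v g) := by
  have hle : ∀ x, RAM.relaxed n A wt u v g x ≤ g x := by
    intro x
    rw [RAM.relaxed]
    split_ifs with hc
    · by_cases hx : x = v
      · subst hx
        simpa using hc.2.le
      · simp [hx]
    · exact le_rfl
  refine ⟨fun x => ?_, fun x => (hle x).trans (h.le x),
    fun x p hp => (hle x).trans (h.upper x p hp), fun x y hxy hlt p hp => ?_⟩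
  · rw [RAM.relaxed]
    split_ifs with hc
    · by_cases hx : (x : ℕ) = v
      · have hadj : H.Adj ⟨u, hu⟩ x := (hA _ _).1 (by simpa [hx] using hc.1)
        have hval := hwt _ _ hadj
        simp only [hx] at hval ⊢
        rw [Function.update_self, hval]
        rcases h.lower ⟨u, hu⟩ with h1 | ⟨p, hp⟩
        · exact Or.inl (h1.trans (le_add_of_nonneg_right (hw _ hadj)))
        · exact Or.inr ⟨p.concat hadj, by rw [walkWeight_concat]; gcongr⟩
      · simpa [hx] using h.lower x
    · exact h.lower x
  · by_cases hlt' : (x : ℕ) < u ∨ (x : ℕ) = u ∧ (y : ℕ) < v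
    · exact (hle y).trans (h.step x y hxy hlt' p hp)
    · obtain ⟨rfl, rfl⟩ : (x : ℕ) = u ∧ (y : ℕ) = v := by omega
      have h1 := h.upper x p hp
      rw [RAM.relaxed, hwt x y hxy]
      split_ifs with hc
      · rw [Function.update_self]
        gcongr
      · have : ¬ g x + w s(x, y) < g y := fun h' => hc ⟨(hA x y).2 hxy, h'⟩
        linarith

/-- If `g x` has reached `D`, the truncation `g y ≤ D` suffices. Otherwise a walk to `x` witnesses
`g x`; prolonging it to `y` and removing cycles leaves fewer than `n` edges, so `n` rounds account
for it. -/
theorem Estimates.isPotential (hw : ∀ e ∈ H.edgeSet, 0 ≤ w e) {g : ℕ → ℝ}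
    (h : Estimates H w s D n 0 0 g) : IsPotential H w fun x => g x := by
  intro x y hxy
  rcases h.lower x with h1 | ⟨p, hp⟩
  · exact (h.le y).trans (h1.trans (le_add_of_nonneg_right (hw _ hxy)))
  · have h2 := h.upper y (p.concat hxy).bypass (by
      have := (p.concat hxy).bypass_isPath.length_lt
      rw [Fintype.card_fin] at this
      exact this.le)
    have h3 := walkWeight_bypass_le hw (p.concat hxy)
    rw [walkWeight_concat] at h3
    linarith

/-- No walk to `t` is lighter than the shortest path `p`, so truncation at `D` does not affect the
value at `t`. -/
theorem Estimates.sub_eq (hw : ∀ e ∈ H.edgeSet, 0 ≤ w e) {t : Fin n} {p : H.Walk s t}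
    (hp : IsShortestPath w p) (hD : D = walkWeight w p) {g : ℕ → ℝ}
    (h : Estimates H w s D n 0 0 g) : walkWeight w p = g t - g s := by
  have hD0 : 0 ≤ D := hD ▸ walkWeight_nonneg hw p
  have hs : g s = 0 := by
    apply le_antisymm
    · simpa [walkWeight_nil] using h.upper s Walk.nil (Nat.zero_le _)
    · rcases h.lower s with h1 | ⟨p', hp'⟩
      · exact hD0.trans h1
      · exact (walkWeight_nonneg hw p').trans hp'
  have ht : g t = D := by
    apply le_antisymm (h.le t)
    rcases h.lower t with h1 | ⟨p', hp'⟩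
    · exact h1
    · rw [hD]
      exact (hp.2 _ p'.bypass_isPath).trans ((walkWeight_bypass_le hw p').trans hp')
  rw [hs, ht, sub_zero, hD]

end Estimates

/-! ### Potentials along the path, and the encoding of matrices and fault lists. -/

theorem le_getVert_succ {V : Type*} {H : SimpleGraph V} {w : Sym2 V → ℝ} {φ : V → ℝ}
    (hw : ∀ e ∈ H.edgeSet, 0 ≤ w e) (hφ : IsPotential H w φ) {x t : V} (r : H.Walk x t)
    (hr : walkWeight w r = φ t - φ x) {i : ℕ} (hi : i < r.length) :
    φ (r.getVert i) ≤ φ (r.getVert (i + 1)) := by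
  obtain ⟨y, z, p, e, r', rfl, hp⟩ := exists_append_cons r i hi
  rw [walkWeight_append, walkWeight_cons] at hr
  have h1 := hφ.sub_le_walkWeight p
  have h2 := hφ.sub_le_walkWeight r'
  have h3 := hw s(y, z) e
  rw [Walk.getVert_append, Walk.getVert_append, if_neg (by omega), if_neg (by omega), hp,
    Nat.sub_self, Nat.add_sub_cancel_left]
  simp only [Walk.getVert_zero, Walk.getVert_cons_succ]
  linarith

theorem walkWeight_eq_sum {V : Type*} {H : SimpleGraph V} (w : Sym2 V → ℝ) {x t : V}
    (r : H.Walk x t) :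
    walkWeight w r = ∑ i ∈ Finset.range r.length, w s(r.getVert i, r.getVert (i + 1)) := by
  induction r with
  | nil => simp [walkWeight_nil]
  | cons h p ih =>
    rw [walkWeight_cons, Walk.length_cons, Finset.sum_range_succ', ih]
    simp only [Walk.getVert_cons_succ, Walk.getVert_zero, zero_add]
    rw [add_comm]

theorem rowMajor_apply {α : Type*} [Zero α] {n : ℕ} (M : Fin n → Fin n → α) (u v : Fin n) :
    rowMajor M (u * n + v) = M u v := by
  have hlt : (u : ℕ) * n + v < n * n := by
    have := Nat.mul_le_mul_right n (Nat.succ_le_of_lt u.2)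
    rw [Nat.succ_mul] at this
    have := v.2
    omega
  have hn : 0 < n := u.pos
  rw [rowMajor, dif_pos hlt]
  congr 1
  · ext
    simp [Fin.coe_divNat, mul_comm _ n, Nat.mul_add_div hn, Nat.div_eq_of_lt v.2]
  · ext
    simp [Fin.coe_modNat, mul_comm _ n, Nat.mod_eq_of_lt v.2]

theorem Enumerates.length_eq {V : Type*} {faults : List (V × V)} {F : Finset (Sym2 V)}
    (h : Enumerates faults F) : faults.length = F.card := by
  classical
  have : (faults.map fun e => s(e.1, e.2)).toFinset = F := by
    ext e
    rw [List.mem_toFinset, h.2]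
  rw [← this, List.toFinset_card_of_nodup h.1, List.length_map]

theorem Enumerates.mem_iff {V : Type*} {faults : List (V × V)} {F : Finset (Sym2 V)}
    (h : Enumerates faults F) (e : Sym2 V) :
    e ∈ F ↔ ∃ (j : ℕ) (hj : j < faults.length), s(faults[j].1, faults[j].2) = e := by
  rw [← h.2 e, List.mem_map]
  constructor
  · rintro ⟨x, hx, rfl⟩
    obtain ⟨j, hj, rfl⟩ := List.mem_iff_getElem.1 hx
    exact ⟨j, hj, rfl⟩
  · rintro ⟨j, hj, rfl⟩
    exact ⟨_, List.getElem_mem hj, rfl⟩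

section Indicator

variable {n : ℕ} {faults : List (Fin n × Fin n)} {F : Finset (Sym2 (Fin n))} {A₁ A₂ : ℕ → ℕ}

open Classical in
theorem faultIndicator_eq (h : Enumerates faults F)
    (h₁ : ∀ (j : ℕ) (hj : j < faults.length), A₁ j = faults[j].1)
    (h₂ : ∀ (j : ℕ) (hj : j < faults.length), A₂ j = faults[j].2) (g : ℕ → ℝ) (lo hi : ℝ) {j : ℕ}
    (hj : j < faults.length) :
    RAM.faultIndicator A₁ A₂ g lo hi j =
      if s(faults[j].1, faults[j].2) ∈ window (fun x : Fin n => g x) F lo hi then 1 else 0 := by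
  rw [RAM.faultIndicator]
  refine if_congr ?_ rfl rfl
  rw [mem_window, h₁ j hj, h₂ j hj]
  simp [(h.mem_iff _).2 ⟨j, hj, rfl⟩]

theorem faultCount_eq (h : Enumerates faults F)
    (h₁ : ∀ (j : ℕ) (hj : j < faults.length), A₁ j = faults[j].1)
    (h₂ : ∀ (j : ℕ) (hj : j < faults.length), A₂ j = faults[j].2) (g : ℕ → ℝ) (lo hi : ℝ) :
    RAM.faultCount faults.length A₁ A₂ g lo hi =
      (window (fun x : Fin n => g x) F lo hi).card := by
  classical
  set W := window (fun x : Fin n => g x) F lo hi with hW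
  have hF : (faults.map fun e => s(e.1, e.2)).toFinset = F := by
    ext e
    rw [List.mem_toFinset, h.2]
  have hcard : W.card = ∑ e ∈ F, if e ∈ W then 1 else 0 := by
    rw [Finset.sum_boole, Finset.filter_mem_eq_inter,
      Finset.inter_eq_right.2 (window_subset _ _ _ _)]
    rfl
  -- Since the list has no repetitions, summing over its indices is summing over `F`.
  rw [hcard, ← hF, List.sum_toFinset _ h.1, List.map_map, ← Fin.sum_univ_fun_getElem,
    RAM.faultCount, Finset.sum_range]
  exact Finset.sum_congr rfl fun j _ => faultIndicator_eq h h₁ h₂ g lo hi j.2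

end Indicator

end Restoration

/-! ### The complete algorithm and its execution. -/

namespace RAM

theorem GreedyDivision.en_le {f k : ℕ} {pos : ℕ → ℝ} {cnt : ℝ → ℝ → ℕ} {i q : ℕ} {st en : ℕ → ℕ}
    {lo hi : ℕ → ℝ} (h : GreedyDivision f k pos cnt i q st en lo hi) {j : ℕ} (hj : j ≤ q) :
    en j ≤ i := by
  induction hj using Nat.decreasingInduction with
  | of_succ j hj ih =>
    have := h.link j hj
    have := h.le (j + 1) hj
    omega
  | self => exact h.last.le

/-- The algorithm: compute distances from the start of the path after deleting the faults, then
divide the path greedily. -/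
def decompose : Program :=
  .seq rowOffsets (.seq deleteFaults (.seq pathWeight (.seq initEstimates
    (.seq bellmanFord dividePath))))

end RAM

namespace Restoration

open SimpleGraph

theorem getD_map_support {n : ℕ} {H : SimpleGraph (Fin n)} {s t : Fin n} (p : H.Walk s t) {j : ℕ}
    (hj : j ≤ p.length) : (p.support.map fun v : Fin n => (v : ℕ)).getD j 0 = p.getVert j := by
  have h : j < p.support.length := by
    rw [p.length_support]
    omega
  rw [List.getD_eq_getElem _ _ (by simpa using h), List.getElem_map, p.support_getElem_eq_getVert]

section Execution

variable {n : ℕ} {G : SimpleGraph (Fin n)} {w : Sym2 (Fin n) → ℝ} {F : Finset (Sym2 (Fin n))}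
  {faults : List (Fin n × Fin n)} {s t : Fin n}

/-- Quotient and remainder modulo `n` recover the pair from its matrix index, so clearing entries
amounts to deleting edges. -/
theorem forall_ne_iff_not_mem (hF : Enumerates faults F) {A₁ A₂ : ℕ → ℕ}
    (h₁ : ∀ (j : ℕ) (hj : j < faults.length), A₁ j = faults[j].1)
    (h₂ : ∀ (j : ℕ) (hj : j < faults.length), A₂ j = faults[j].2) (x y : Fin n) :
    (∀ j < faults.length, (x : ℕ) * n + y ≠ A₁ j * n + A₂ j ∧
      (x : ℕ) * n + y ≠ A₂ j * n + A₁ j) ↔ s(x, y) ∉ F := by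
  have hinj : ∀ a b : Fin n, (x : ℕ) * n + y = a * n + b ↔ x = a ∧ y = b := by
    intro a b
    refine ⟨fun h => ?_, fun h => by rw [h.1, h.2]⟩
    have hn : 0 < n := x.pos
    have h1 : (x : ℕ) = a := by
      have := congrArg (· / n) h
      simpa [mul_comm _ n, Nat.mul_add_div hn, Nat.div_eq_of_lt] using this
    rw [h1] at h
    exact ⟨Fin.ext h1, Fin.ext (by omega)⟩
  rw [hF.mem_iff]
  push Not
  refine forall_congr' fun j => forall_congr' fun hj => ?_
  rw [h₁ j hj, h₂ j hj, Ne, Ne, hinj, hinj, Ne, Sym2.eq_iff]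
  constructor
  · rintro ⟨h1, h2⟩ (⟨h3, h4⟩ | ⟨h3, h4⟩)
    · exact h1 ⟨h3.symm, h4.symm⟩
    · exact h2 ⟨h4.symm, h3.symm⟩
  · intro h
    exact ⟨fun h' => h (Or.inl ⟨h'.1.symm, h'.2.symm⟩),
      fun h' => h (Or.inr ⟨h'.2.symm, h'.1.symm⟩)⟩

/-- On every input, the algorithm finds a greedy division of the path with respect to a function
`g` that is a potential of `G` minus the faults and grows along the path by its weight. -/
theorem decompose_runs (hw : ∀ e ∈ G.edgeSet, 0 ≤ w e) (hF : Enumerates faults F)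
    (π : (G.deleteEdges (F : Set (Sym2 (Fin n)))).Walk s t) (hπ : IsShortestPath w π) (k : ℕ)
    {A₁ A₂ A₃ : ℕ → ℕ} (hA₁ : A₁ = fun i => (faults.map fun e => (e.1 : ℕ)).getD i 0)
    (hA₂ : A₂ = fun i => (faults.map fun e => (e.2 : ℕ)).getD i 0)
    (hA₃ : A₃ = fun i => (π.support.map fun v : Fin n => (v : ℕ)).getD i 0) :
    RAM.Runs RAM.decompose (initState G w faults π.support k) (5000 * (n + F.card) ^ 3)
      fun σ => ∃ (g : ℕ → ℝ) (q : ℕ) (st en : ℕ → ℕ) (lo hi : ℕ → ℝ),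
        IsPotential (G.deleteEdges (F : Set (Sym2 (Fin n)))) w (fun x => g x) ∧
        walkWeight w π = g t - g s ∧
        RAM.GreedyDivision F.card k (fun i => g (A₃ i)) (RAM.faultCount F.card A₁ A₂ g)
          π.length q st en lo hi ∧
        RAM.HoldsPieces F.card A₁ A₂ A₃ g q st en lo hi σ := by
  let H := G.deleteEdges (F : Set (Sym2 (Fin n)))
  have hwH : ∀ e ∈ H.edgeSet, 0 ≤ w e := fun e he => hw e (edgeSet_mono (deleteEdges_le _) he)
  have hn : 0 < n := s.pos
  have hlen := hF.length_eq
  have hfle : faults.length ≤ n + F.card := by omega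
  have hsup : π.support.length = π.length + 1 := π.length_support
  have hmle : π.support.length ≤ n := by
    have := hπ.1.length_lt
    rw [Fintype.card_fin] at this
    omega
  have e₁ : ∀ (j : ℕ) (hj : j < faults.length), A₁ j = faults[j].1 := by
    intro j hj
    simp [hA₁, hj]
  have e₂ : ∀ (j : ℕ) (hj : j < faults.length), A₂ j = faults[j].2 := by
    intro j hj
    simp [hA₂, hj]
  have e₃ : ∀ j ≤ π.length, A₃ j = π.getVert j := by
    intro j hj
    rw [hA₃]
    exact getD_map_support π hj
  set σ₀ := initState G w faults π.support k with hσ₀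
  have v0 : σ₀.nvar 0 = n := rfl
  have v1 : σ₀.nvar 1 = faults.length := rfl
  have v2 : σ₀.nvar 2 = π.support.length := rfl
  have v3 : σ₀.nvar 3 = k := rfl
  have a1 : σ₀.narr 1 = A₁ := hA₁ ▸ rfl
  have a2 : σ₀.narr 2 = A₂ := hA₂ ▸ rfl
  have a3 : σ₀.narr 3 = A₃ := by
    rw [hA₃, hσ₀]
    simp [initState, ← List.map_eq_flatMap]
    rfl
  have a6 : ∀ i, σ₀.narr 6 i = 0 := fun _ => rfl
  have hadj : ∀ x y : Fin n, 0 < σ₀.narr 0 (x * n + y) ↔ G.Adj x y := by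
    intro x y
    simp only [hσ₀, initState, ↓reduceIte, rowMajor_apply]
    split_ifs with h <;> simp [h]
  have hwt : ∀ x y : Fin n, G.Adj x y → σ₀.warr 0 (x * n + y) = w s(x, y) := by
    intro x y hxy
    simp only [hσ₀, initState, ↓reduceIte, rowMajor_apply, if_pos hxy]
  have b₁ : ∀ j < faults.length, A₁ j < n := fun j hj => e₁ j hj ▸ (faults[j].1).2
  have b₂ : ∀ j < faults.length, A₂ j < n := fun j hj => e₂ j hj ▸ (faults[j].2).2
  have b₃ : ∀ j < π.support.length, A₃ j < n := fun j hj => by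
    rw [e₃ j (by omega)]
    exact (π.getVert j).2
  -- `X` bounds all loop lengths: `n`, the number of faults, and the number of vertices of the
  -- simple path `π`.
  obtain ⟨X, hX⟩ : ∃ X, X = n + F.card := ⟨_, rfl⟩
  rw [← hX]
  have hnX : n ≤ X := by omega
  refine (RAM.Runs.seq (B₂ := 400 * X + 600 + (X * (X * (X * 60 + 60) + 60) + 60) +
    (X * (1000 * X + 1500) + 200)) (RAM.rowOffsets_runs σ₀ X (by omega)) ?_).mono ?_
    fun _ h => h
  swap
  -- As `X ≥ 1`, each power in the total bound is at most `X ^ 3`; the coefficients add up to 4140.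
  · have hX1 : 1 ≤ X := by omega
    have h2 : X ≤ X ^ 3 := Nat.le_self_pow (by omega) X
    have h3 : X ^ 2 ≤ X ^ 3 := Nat.pow_le_pow_right hX1 (by omega)
    have h4 : 1 ≤ X ^ 3 := Nat.one_le_pow _ _ hX1
    ring_nf
    omega
  rintro σ₁ ⟨hF₁, h7⟩
  rw [v0] at h7
  have w0 : σ₁.nvar 0 = n := hF₁.nvar 0 (by decide)
  have w1 : σ₁.nvar 1 = faults.length := hF₁.nvar 1 (by decide)
  refine (RAM.Runs.seq (B₂ := 300 * X + 500 + (X * (X * (X * 60 + 60) + 60) + 60) +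
    (X * (1000 * X + 1500) + 200)) (RAM.deleteFaults_runs σ₁ X (by omega) (by rwa [w0])
    (by rw [w0, w1, hF₁.narr 1 (by decide), a1]; exact b₁)
    (by rw [w0, w1, hF₁.narr 2 (by decide), a2]; exact b₂)) ?_).mono (by omega) fun _ h => h
  rintro σ₂ ⟨hF₂, h0⟩
  rw [w0, w1, hF₁.narr 0 (by decide), hF₁.narr 1 (by decide), hF₁.narr 2 (by decide), a1, a2]
    at h0
  have hadj₂ : ∀ x y : Fin n, 0 < σ₂.narr 0 (x * n + y) ↔ H.Adj x y := by
    intro x y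
    rw [h0, hadj, forall_ne_iff_not_mem hF e₁ e₂, deleteEdges_adj]
    simp
  have x0 : σ₂.nvar 0 = n := (hF₂.nvar 0 (by decide)).trans w0
  have x2 : σ₂.nvar 2 = π.support.length := by
    rw [hF₂.nvar 2 (by decide), hF₁.nvar 2 (by decide), v2]
  have x3 : σ₂.narr 3 = A₃ := by rw [hF₂.narr 3 (by decide), hF₁.narr 3 (by decide), a3]
  have xw : σ₂.warr 0 = σ₀.warr 0 := by rw [hF₂.warr 0 (by decide), hF₁.warr 0 (by decide)]
  have h7₂ : σ₂.narr 7 = σ₁.narr 7 := hF₂.narr 7 (by decide)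
  refine (RAM.Runs.seq (B₂ := 200 * X + 300 + (X * (X * (X * 60 + 60) + 60) + 60) +
    (X * (1000 * X + 1500) + 200)) (RAM.pathWeight_runs σ₂ X (by omega) (by rwa [x0, h7₂])
    (by rw [x0, x2, x3]; exact b₃)) ?_).mono (by omega) fun _ h => h
  rintro σ₃ ⟨hF₃, hD⟩
  have hD : σ₃.wvar 0 = walkWeight w π := by
    rw [hD, x2, x0, x3, xw, hsup, Nat.add_sub_cancel, walkWeight_eq_sum]
    refine Finset.sum_congr rfl fun i hi => ?_
    have hi := Finset.mem_range.1 hi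
    rw [e₃ i hi.le, e₃ (i + 1) hi]
    exact hwt _ _ (deleteEdges_le _ (π.adj_getVert_succ hi))
  have y0 : σ₃.nvar 0 = n := (hF₃.nvar 0 (by decide)).trans x0
  have y3 : σ₃.narr 3 = A₃ := (hF₃.narr 3 (by decide)).trans x3
  refine (RAM.Runs.seq (B₂ := 100 * X + 200 + (X * (X * (X * 60 + 60) + 60) + 60) +
    (X * (1000 * X + 1500) + 200)) (RAM.initEstimates_runs σ₃ X (by omega)) ?_).mono (by omega)
    fun _ h => h
  rintro σ₄ ⟨hF₄, hinit⟩
  rw [y0, y3, e₃ 0 (Nat.zero_le _), Walk.getVert_zero, hD] at hinit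
  have z0 : σ₄.nvar 0 = n := (hF₄.nvar 0 (by decide)).trans y0
  have z7 : σ₄.narr 7 = σ₁.narr 7 := by
    rw [hF₄.narr 7 (by decide), hF₃.narr 7 (by decide), h7₂]
  have zA : σ₄.narr 0 = σ₂.narr 0 := by rw [hF₄.narr 0 (by decide), hF₃.narr 0 (by decide)]
  have zw : σ₄.warr 0 = σ₀.warr 0 := by
    rw [hF₄.warr 0 (by decide), hF₃.warr 0 (by decide), xw]
  refine (RAM.Runs.seq (B₂ := X * (1000 * X + 1500) + 200) (RAM.bellmanFord_runs σ₄ X (by omega)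
    (by rwa [z0, z7]) (Estimates H w s (walkWeight w π))
    (Estimates.init (walkWeight_nonneg hwH π) fun x => hinit x x.2) ?_ ?_ ?_) ?_).mono (by omega)
    fun _ h => h
  · intro r u v g hu hv h
    rw [z0] at hu hv ⊢
    rw [zA, zw]
    exact h.relaxed hadj₂ (fun x y hxy => hwt x y (deleteEdges_le _ hxy)) hwH hu hv
  · intro r u g h
    rw [z0] at h
    exact h.row
  · intro r g h
    rw [z0] at h
    exact h.round
  rintro σ₅ ⟨hF₅, hest⟩
  rw [z0] at hest
  have hinput : RAM.Input F.card π.support.length k A₁ A₂ A₃ (σ₅.warr 1) σ₅ := by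
    refine ⟨?_, ?_, ?_, ?_, ?_, ?_, rfl⟩
    · rw [hF₅.nvar 1 (by decide), hF₄.nvar 1 (by decide), hF₃.nvar 1 (by decide),
        hF₂.nvar 1 (by decide), w1, hlen]
    · rw [hF₅.nvar 2 (by decide), hF₄.nvar 2 (by decide), hF₃.nvar 2 (by decide), x2]
    · rw [hF₅.nvar 3 (by decide), hF₄.nvar 3 (by decide), hF₃.nvar 3 (by decide),
        hF₂.nvar 3 (by decide), hF₁.nvar 3 (by decide), v3]
    · rw [hF₅.narr 1 (by decide), hF₄.narr 1 (by decide), hF₃.narr 1 (by decide),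
        hF₂.narr 1 (by decide), hF₁.narr 1 (by decide), a1]
    · rw [hF₅.narr 2 (by decide), hF₄.narr 2 (by decide), hF₃.narr 2 (by decide),
        hF₂.narr 2 (by decide), hF₁.narr 2 (by decide), a2]
    · rw [hF₅.narr 3 (by decide), hF₄.narr 3 (by decide), y3]
  refine (RAM.dividePath_runs (X := X) hinput (by omega) (by omega) fun j => ?_).mono le_rfl ?_
  · rw [hF₅.narr 6 (by decide), hF₄.narr 6 (by decide), hF₃.narr 6 (by decide),
      hF₂.narr 6 (by decide), hF₁.narr 6 (by decide), a6]
  · rintro σ ⟨q, st, en, lo, hi, hdiv, hout⟩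
    rw [hsup, Nat.add_sub_cancel] at hdiv
    exact ⟨σ₅.warr 1, q, st, en, lo, hi, hest.isPotential hwH, hest.sub_eq hwH hπ rfl, hdiv, hout⟩

end Execution

end Restoration

/-! ### The main theorem. -/

theorem theorem1p7 :
    ∃ (alg : RAM.Program) (C c d : ℕ),
      ∀ (n : ℕ) (G : SimpleGraph (Fin n)) (w : Sym2 (Fin n) → ℝ)
        (F : Finset (Sym2 (Fin n))) (faults : List (Fin n × Fin n)) (s t : Fin n)
        (π : (G.deleteEdges (F : Set (Sym2 (Fin n)))).Walk s t) (k : ℕ),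
        (∀ e ∈ G.edgeSet, 0 ≤ w e) →
        (F : Set (Sym2 (Fin n))) ⊆ G.edgeSet →
        Restoration.Enumerates faults F →
        Restoration.IsShortestPath w π →
        1 ≤ k →
        ∃ (T : ℕ) (σ : RAM.State) (L : List (Restoration.Piece G)),
          RAM.Exec alg (Restoration.initState G w faults π.support k) T σ ∧
          T ≤ c * (n + F.card) ^ d ∧
          Restoration.HoldsOutput σ faults L ∧
          Restoration.IsDecomposition (π.mapLe (SimpleGraph.deleteEdges_le _)) L ∧
          L.length ≤ C * k + 1 ∧
          ∀ P ∈ L, P.faults ⊆ F ∧ (P.faults.card : ℝ) ≤ (F.card : ℝ) / k ∧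
            Restoration.IsShortestPath w P.path := by
  refine ⟨RAM.decompose, 4, 5000, 3, ?_⟩
  intro n G w F faults s t π k hw _ hF hπ hk
  obtain ⟨A₁, hA₁⟩ : ∃ A : ℕ → ℕ, A = fun i => (faults.map fun e => (e.1 : ℕ)).getD i 0 :=
    ⟨_, rfl⟩
  obtain ⟨A₂, hA₂⟩ : ∃ A : ℕ → ℕ, A = fun i => (faults.map fun e => (e.2 : ℕ)).getD i 0 :=
    ⟨_, rfl⟩
  obtain ⟨A₃, hA₃⟩ : ∃ A : ℕ → ℕ, A = fun i => (π.support.map fun v : Fin n => (v : ℕ)).getD i 0 :=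
    ⟨_, rfl⟩
  obtain ⟨T, σ, hexec, hT, g, q, st, en, lo, hi, hφ, hπw, hdiv, hout⟩ :=
    Restoration.decompose_runs hw hF π hπ k hA₁ hA₂ hA₃
  have hlen := hF.length_eq
  have e₁ : ∀ (j : ℕ) (hj : j < faults.length), A₁ j = faults[j].1 := by
    intro j hj
    simp [hA₁, hj]
  have e₂ : ∀ (j : ℕ) (hj : j < faults.length), A₂ j = faults[j].2 := by
    intro j hj
    simp [hA₂, hj]
  have e₃ : ∀ j ≤ π.length, A₃ j = π.getVert j := by
    intro j hj
    rw [hA₃]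
    exact Restoration.getD_map_support π hj
  have hen : ∀ j ≤ q, A₃ (en j) = π.getVert (en j) := fun j hj => e₃ _ (hdiv.en_le hj)
  have hst : ∀ j ≤ q, A₃ (st j) = π.getVert (st j) :=
    fun j hj => e₃ _ ((hdiv.le j hj).trans (hdiv.en_le hj))
  have hcount : ∀ l u, RAM.faultCount F.card A₁ A₂ g l u =
      (Restoration.window (fun x : Fin n => g x) F l u).card := by
    intro l u
    rw [← hlen]
    exact Restoration.faultCount_eq hF e₁ e₂ g l u
  have hwH : ∀ e ∈ (G.deleteEdges (F : Set (Sym2 (Fin n)))).edgeSet, 0 ≤ w e :=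
    fun e he => hw e (SimpleGraph.edgeSet_mono (SimpleGraph.deleteEdges_le _) he)
  have hmono : ∀ a b, a ≤ b → b ≤ π.length → g (π.getVert a) ≤ g (π.getVert b) := by
    intro a b hab
    induction b, hab using Nat.le_induction with
    | base => exact fun _ => le_rfl
    | succ b _ ih =>
      exact fun hb => (ih (by omega)).trans (Restoration.le_getVert_succ hwH hφ π hπw hb)
  -- The counting lemma is applied to the potentials of the starts; an interval consists of a piece
  -- together with the separating edge after it.
  have hq : q ≤ 4 * k := by
    refine Restoration.card_intervals_le (fun x : Fin n => g x) F k q hk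
      (fun j => g (π.getVert (st j))) ?_ ?_
    · intro j hj
      have h1 := hdiv.le j hj.le
      have h2 := hdiv.link j hj
      exact hmono _ _ (by omega) ((hdiv.le (j + 1) hj).trans (hdiv.en_le hj))
    · intro j hj
      have := hdiv.bad j hj
      rwa [hst j hj.le, hst (j + 1) hj, hcount, hcount] at this
  obtain ⟨L, hL, hdec, hprop⟩ := Restoration.exists_decomposition hw hφ q π hπ.1 hπw st en
    (fun j => Restoration.window (fun x : Fin n => g x) F (lo j) (hi j)) hdiv.start hdiv.le
    hdiv.link hdiv.last (fun j _ => Restoration.window_subset _ _ _ _) (fun j hj => by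
      have := hdiv.good j hj
      rw [hst j hj, hen j hj] at this
      rcases this with ⟨h1, h2⟩ | ⟨h1, h2⟩
      · exact Or.inl (by rw [h1, h2])
      · exact Or.inr (by rw [h1, h2]))
  refine ⟨T, σ, L, hexec, hT, ⟨?_, ?_⟩, hdec, by omega, ?_⟩
  · rw [hout.nvar_four, hL]
  · intro i hi
    have hiq : i ≤ q := by omega
    obtain ⟨h1, h2, h3, -⟩ := hprop i hi
    refine ⟨?_, ?_, ?_⟩
    · rw [hout.narr_four i hiq, hst i hiq, h1]
    · rw [hout.narr_five i hiq, hen i hiq, h2]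
    · intro j hj
      rw [hlen, hout.narr_six i hiq j (by omega), Restoration.faultIndicator_eq hF e₁ e₂ g _ _ hj,
        h3]
  · intro P hP
    obtain ⟨i, hi, rfl⟩ := List.mem_iff_getElem.1 hP
    obtain ⟨-, -, h3, h4⟩ := hprop i hi
    refine ⟨h3 ▸ Restoration.window_subset _ _ _ _, ?_, h4⟩
    -- The machine guarantees `k * |F_i| ≤ f` in natural numbers; dividing by `k ≥ 1` gives the real
    -- inequality.
    have hs := hdiv.small i (by omega)
    rw [hcount, ← h3] at hs
    rw [le_div_iff₀ (by exact_mod_cast hk), mul_comm]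
    exact_mod_cast hs
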